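/- Let $P=(p_{ij})$ be an irreducible non-negative integer $R\times R$ matrix with Perron--Frobenius eigenvalue $\lambda>1$ (the eigenvalue having an eigenvector with positive coordinates), let $p,q$ be positive integers such that $r=p/q$ is greater than every row sum $m_i=\sum_j p_{ij}$ of $P$, and put $\alpha=\log_\lambda(r)$. Let $\Gamma$ be the directed graph with vertices $v_1,\dots,v_R$ and $p_{ij}$ edges from $v_i$ to $v_j$; list the edges starting at $v_i$ as $e_{i,1},\dots,e_{i,m_i}$, let $v_{\sigma(i,k)}$ be the terminal vertex of $e_{i,k}$, and let $T$ be a maximal tree of $\Gamma$. The group $G_{r,P}$ is given by the finite presentation with generators $a_{i,k}$ and $s_{i,k}$ ($1\le i\le R$, $1\le k\le m_i$) and $b_{i,k}$ ($0\le k\le m_i-2$), where we also write $b_{i,m_i-1}=a_{i,m_i}$ and $c_i=b_{i,0}$, and with relations - $a_{i,k}b_{i,k}=b_{i,k-1}$ and $b_{i,k}a_{i,k}=b_{i,k-1}$ for $1\le k\le m_i-1$ (these define the vertex group $V_{m_i}$, whose diagonal element is $c_i=a_{i,1}\cdots a_{i,m_i}$); - $s_{i,k}^{-1}a_{i,k}^{\,p}s_{i,k}=c_{\sigma(i,k)}^{\,q}$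 for every edge $e_{i,k}$; - $s_{i,k}=1$ for every edge $e_{i,k}$ of $T$. For a word $u$ representing $1$, $\mathrm{Area}(u)$ is the least $n$ such that $u$ is freely equal to a product of $n$ conjugates of relators and inverses of relators; $|w|$ is the length of the word $w$; and $\delta(y)=\max\{\mathrm{Area}(w): w=1 \text{ in } G_{r,P},\ |w|\le y\}$ is the Dehn function of this presentation. Then there is a constant $E>0$, depending only on $P$ and $r=p/q$ (given as the fraction $p/q$), such that for every choice of the labelling and of $T$: 1. if $w$ is a word in the generators and their inverses (in particular, any word in the $a_{i,k}$ and $s_{i,k}$) that represents $x^N$ for some $N\in\mathbb Z$, where $x$ is one of the generators $a_{i,k}$ or one of the diagonal elements $c_i$, then $$\mathrm{Area}(w\,x^{-N})\le E\,|w|^{2\alpha};$$ 2. consequently (case $N=0$) $\delta(y)\le E\,y^{2\alpha}$ for all real $y\ge 0$, which is the upper bound $\delta(y)\preceq y^{2\alpha}$ for the Dehn function of $G_{r,P}$. -/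

import Mathlib

namespace Snowflake

/-! ### Area and Dehn function of a presentation -/

section Presentation

variable {α : Type*}

/-- `u = ∏_{j=1}^k g_j r_j g_j⁻¹` in the free group, with every `r_j` a relator or the inverse of
a relator. -/
def IsRelatorProduct (rels : Set (FreeGroup α)) (u : FreeGroup α) (k : ℕ) : Prop :=
  ∃ l : List (FreeGroup α × FreeGroup α),
    l.length = k ∧ (∀ x ∈ l, x.2 ∈ rels ∨ x.2⁻¹ ∈ rels) ∧
      (l.map fun x => x.1 * x.2 * x.1⁻¹).prod = u

/-- The area of `u`: the least number of conjugates of relators (and their inverses) whose product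
is freely equal to `u`. It is meaningful when `u` represents `1`
(see `exists_isRelatorProduct_iff`). -/
noncomputable def area (rels : Set (FreeGroup α)) (u : FreeGroup α) : ℕ :=
  sInf {k | IsRelatorProduct rels u k}

/-- The set of which `area` is the minimum is nonempty exactly when `u` represents `1`. -/
theorem exists_isRelatorProduct_iff (rels : Set (FreeGroup α)) (u : FreeGroup α) :
    (∃ k, IsRelatorProduct rels u k) ↔ PresentedGroup.mk rels u = 1 := by
  constructor
  · rintro ⟨k, l, -, hl, rfl⟩
    rw [map_list_prod]
    apply List.prod_eq_one
    intro y hy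
    simp only [List.map_map, List.mem_map, Function.comp_apply] at hy
    obtain ⟨x, hx, rfl⟩ := hy
    have h : PresentedGroup.mk rels x.2 = 1 := by
      rcases hl x hx with h | h
      · exact PresentedGroup.one_of_mem h
      · simpa using PresentedGroup.one_of_mem h
    simp [h]
  · intro h
    have h' : u ∈ Subgroup.closure (Group.conjugatesOfSet rels) :=
      PresentedGroup.mk_eq_one_iff.mp h
    clear h
    induction h' using Subgroup.closure_induction with
    | mem x hx =>
      obtain ⟨r, hr, hrx⟩ := Group.mem_conjugatesOfSet_iff.mp hx
      obtain ⟨g, rfl⟩ := isConj_iff.mp hrx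
      exact ⟨1, [(g, r)], rfl, by simp [hr], by simp⟩
    | one => exact ⟨0, [], rfl, by simp, by simp⟩
    | mul x y _ _ ihx ihy =>
      obtain ⟨k, l, -, hl, rfl⟩ := ihx
      obtain ⟨k', l', -, hl', rfl⟩ := ihy
      refine ⟨_, l ++ l', rfl, ?_, by simp⟩
      intro z hz
      rcases List.mem_append.mp hz with h | h
      · exact hl z h
      · exact hl' z h
    | inv x _ ih =>
      obtain ⟨k, l, -, hl, rfl⟩ := ih
      refine ⟨_, (l.map fun x => (x.1, x.2⁻¹)).reverse, rfl, ?_, ?_⟩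
      · intro z hz
        simp only [List.mem_reverse, List.mem_map] at hz
        obtain ⟨y, hy, rfl⟩ := hz
        simpa [or_comm] using hl y hy
      · rw [List.prod_inv_reverse]
        simp [List.map_reverse, Function.comp_def, mul_assoc]

/-- The Dehn function `δ(x) = max {Area(w) : w = 1 in the group, |w| ≤ x}` of a presentation (with
finitely many generators, so that there are finitely many such words `w`). A word is a list of
letters with signs; it need not be reduced. -/
noncomputable def dehn (rels : Set (FreeGroup α)) (x : ℝ) : ℕ :=
  sSup {k | ∃ w : List (α × Bool), (w.length : ℝ) ≤ x ∧
    PresentedGroup.mk rels (FreeGroup.mk w) = 1 ∧ area rels (FreeGroup.mk w) = k}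

end Presentation

/-! ### The graph `Γ` and the group `G_{r,P}`

The vertices of `Γ` are `Fin R`. The edges with initial vertex `i` are listed as `(i, k)` with
`k : Fin (m i)`, where `m i` is the `i`-th row sum of `P`; the terminal vertex of `(i, k)` is
`σ i k`. -/

section Group

variable {R : ℕ}

/-- The `i`-th row sum of `P`. -/
def rowSum (P : Matrix (Fin R) (Fin R) ℕ) (i : Fin R) : ℕ := ∑ j, P i j

/-- `σ` labels the edges of the directed graph with transition matrix `P`: there are `P i j`
edges from `i` to `j`. -/
def IsEdgeLabelling (P : Matrix (Fin R) (Fin R) ℕ)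
    (σ : (i : Fin R) → Fin (rowSum P i) → Fin R) : Prop :=
  ∀ i j, Fintype.card {k : Fin (rowSum P i) // σ i k = j} = P i j

/-- `lam` is the Perron–Frobenius eigenvalue of `P`: the eigenvalue that has an eigenvector with
positive coordinates. -/
def IsPerronFrobeniusEigenvalue (P : Matrix (Fin R) (Fin R) ℕ) (lam : ℝ) : Prop :=
  ∃ v : Fin R → ℝ, (∀ i, 0 < v i) ∧ (P.map (Nat.cast : ℕ → ℝ)).mulVec v = lam • v

/-- The set `T` of edges is a maximal tree of `Γ` (ignoring the directions of the edges): it has no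
loops and no two parallel edges, and the resulting simple graph on all vertices is a tree. -/
def IsMaximalTree {m : Fin R → ℕ} (σ : (i : Fin R) → Fin (m i) → Fin R)
    (T : Set ((i : Fin R) × Fin (m i))) : Prop :=
  (∀ e ∈ T, σ e.1 e.2 ≠ e.1) ∧
  Set.InjOn (fun e : (i : Fin R) × Fin (m i) => s(e.1, σ e.1 e.2)) T ∧
  (SimpleGraph.fromEdgeSet
    ((fun e : (i : Fin R) × Fin (m i) => s(e.1, σ e.1 e.2)) '' T)).IsTree

/-- The letters: for each vertex `i`, the standard generators `a_1, …, a_m` of the vertex group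
`V_m`, where `m = m i` (written here `a i 0, …, a i (m - 1)`), its further generators
`b_0, …, b_{m-2}`, and the stable letters `s` of the edges starting at `i`. -/
inductive Letter (m : Fin R → ℕ) : Type
  | a (i : Fin R) (k : Fin (m i)) : Letter m
  | b (i : Fin R) (k : Fin (m i - 1)) : Letter m
  | s (i : Fin R) (k : Fin (m i)) : Letter m

variable {m : Fin R → ℕ}

/-- The standard generator `a_{k+1}` of the vertex group at `i`. -/
def aGen (i : Fin R) (k : Fin (m i)) : FreeGroup (Letter m) := FreeGroup.of (Letter.a i k)

/-- The stable letter of the edge `(i, k)`. -/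
def sGen (i : Fin R) (k : Fin (m i)) : FreeGroup (Letter m) := FreeGroup.of (Letter.s i k)

/-- The element `b_k` of the vertex group at `i`, for `0 ≤ k ≤ m - 1`, with the convention
`b_{m-1} = a_m`. -/
def bGen (i : Fin R) (k : Fin (m i)) : FreeGroup (Letter m) :=
  if h : (k : ℕ) < m i - 1 then FreeGroup.of (Letter.b i ⟨k, h⟩) else aGen i k

/-- The diagonal element `c_i = b_0` of the vertex group at `i` (`= a_1` if `m i = 1`). For
`m i = 0`, which does not occur for irreducible matrices, it is `1`. -/
def cGen (i : Fin R) : FreeGroup (Letter m) :=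
  if h : 0 < m i then bGen i ⟨0, h⟩ else 1

/-- The relators, one for each 2-cell of the complex:
* `a_k b_k = b_{k-1}` and `b_k a_k = b_{k-1}` for `1 ≤ k ≤ m - 1`, in each vertex group `V_m`;
* `s_e⁻¹ a_e ^ p s_e = c_{σ(e)} ^ q` for each edge `e`;
* `s_e = 1` for each edge `e` of the maximal tree `T`. -/
inductive IsRelator (p q : ℕ) (σ : (i : Fin R) → Fin (m i) → Fin R)
    (T : Set ((i : Fin R) × Fin (m i))) : FreeGroup (Letter m) → Prop
  | left (i : Fin R) (k : ℕ) (hk : k + 1 < m i) :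
      IsRelator p q σ T
        (aGen i ⟨k, Nat.lt_of_succ_lt hk⟩ * bGen i ⟨k + 1, hk⟩ *
          (bGen i ⟨k, Nat.lt_of_succ_lt hk⟩)⁻¹)
  | right (i : Fin R) (k : ℕ) (hk : k + 1 < m i) :
      IsRelator p q σ T
        (bGen i ⟨k + 1, hk⟩ * aGen i ⟨k, Nat.lt_of_succ_lt hk⟩ *
          (bGen i ⟨k, Nat.lt_of_succ_lt hk⟩)⁻¹)
  | strip (i : Fin R) (k : Fin (m i)) :
      IsRelator p q σ T
        ((sGen i k)⁻¹ * aGen i k ^ p * sGen i k * (cGen (σ i k) ^ q)⁻¹)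
  | tree (i : Fin R) (k : Fin (m i)) (h : ⟨i, k⟩ ∈ T) : IsRelator p q σ T (sGen i k)

/-- The set of relators of `G_{r,P}`, for `r = p/q`. -/
def relators (p q : ℕ) (σ : (i : Fin R) → Fin (m i) → Fin R)
    (T : Set ((i : Fin R) × Fin (m i))) : Set (FreeGroup (Letter m)) :=
  {u | IsRelator p q σ T u}

/-- The group `G_{r,P}`, for `r = p/q`: the fundamental group of the graph of groups with
underlying graph `Γ`, vertex groups `V_{m i}` and infinite cyclic edge groups. -/
abbrev G (p q : ℕ) (σ : (i : Fin R) → Fin (m i) → Fin R)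
    (T : Set ((i : Fin R) × Fin (m i))) : Type :=
  PresentedGroup (relators p q σ T)

end Group

end Snowflake

/-!
The vertex group `V_m` is the amalgam of the groups `⟨a_k⟩ × ⟨b_k⟩` for `k < m` and of the cyclic
group `⟨a_m⟩`, where the diagonal element `b_{k-1} = a_k b_k` of each is identified with the second
basis element of the preceding one, and the diagonal element of `⟨a_m⟩` is `b_{m-1} = a_m`. For
uniformity the group `⟨a_m⟩` is enlarged to `ℤ × ℤ` with `⟨a_m⟩` as the diagonal. Thus `G_{r,P}`
is described by a graph of groups with vertex groups `ℤ × ℤ` (`planeGraph`). All edge groups are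
infinite cyclic, and they lie in one of the three directions `a`, `b`, `d = a b` of a vertex group.

*Reduction to paths.* The edges of a maximal tree, that is, of `T` together with the edges between
the parts of the same `V_m`, are trivial in `G_{r,P}`. Inserting tree paths turns a word into a
path, with a linear change of length and of area (`exists_path_of_word`). As every vertex group is
a copy of the same abelian group `ℤ × ℤ`, the fundamental groupoid of the graph of groups acts on
normal forms over a single copy of it; transported along the tree this becomes an action of
`G_{r,P}` (`IsPotential.lift_relator`). It yields Britton's lemma
(`PlaneGraph.IsStable.of_pathPerm_eq`): a closed path that represents an element of a vertex group
arises from generators by concatenation and by conjugation `s w s⁻¹` with edges, where `w`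
represents an element of an edge group.

*Distortion.* Put `θ = log_λ r`. The Perron–Frobenius eigenvector gives the directions weights `ω`
(`nodeWeighting`) such that a path `w` representing `N` times the direction `x` satisfies
`ω_x |N| ^ (1 / θ) ≤ |w|`. As `t ↦ t ^ (1 / θ)` is subadditive this passes to concatenations, and
crossing an edge preserves it since `p ^ (1 / θ) = λ q ^ (1 / θ)`; no additive or multiplicative
error accumulates in the induction.

*Area.* A closed path at a vertex is a product of pieces, each of which represents a power of one of
the three directions. The pieces are collected to `a ^ A b ^ B d ^ D`. Only pairs of different
directions have a cost, and the cost of a pair with exponents `M`, `N` is a multiple of `|M| |N|`,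
hence of `|u| ^ θ |v| ^ θ` for the lengths of the pieces. If the path represents a power of a single
direction, the remaining terms cancel at a cost of the same form. These costs are the cross terms
in `(|u| ^ θ + |v| ^ θ) ^ 2 ≤ ((|u| + |v|) ^ θ) ^ 2`, so that the bound `E |w| ^ (2 θ)` for the
pieces passes to the whole path with the same constant `E`. This bookkeeping is the property
`PlaneGraph.Collectible`, and `PlaneGraph.isStable_collectible` shows that Britton's lemma applies
to it.
-/

/-! ### The metric on the free group given by the number of relators -/

namespace Snowflake

section Near

variable {β : Type*} {rels : Set (FreeGroup β)} {u v w x y z : FreeGroup β} {k l : ℝ}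

/-- `u` and `v` differ by at most `k` conjugates of relators. This is a bi-invariant metric on the
free group; `k` is real since the bounds for it will be. -/
def Near (rels : Set (FreeGroup β)) (u v : FreeGroup β) (k : ℝ) : Prop :=
  ∃ n : ℕ, IsRelatorProduct rels (u * v⁻¹) n ∧ (n : ℝ) ≤ k

theorem IsRelatorProduct.mul {m n : ℕ} (hu : IsRelatorProduct rels u m)
    (hv : IsRelatorProduct rels v n) : IsRelatorProduct rels (u * v) (m + n) := by
  obtain ⟨l, rfl, hl, rfl⟩ := hu
  obtain ⟨l', rfl, hl', rfl⟩ := hv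
  refine ⟨l ++ l', by simp, ?_, by simp⟩
  intro z hz
  rcases List.mem_append.mp hz with h | h
  exacts [hl z h, hl' z h]

theorem IsRelatorProduct.conj {m : ℕ} (hu : IsRelatorProduct rels u m) (g : FreeGroup β) :
    IsRelatorProduct rels (g * u * g⁻¹) m := by
  obtain ⟨l, rfl, hl, rfl⟩ := hu
  refine ⟨l.map fun x => (g * x.1, x.2), by simp, ?_, ?_⟩
  · intro z hz
    obtain ⟨y, hy, rfl⟩ := List.mem_map.mp hz
    exact hl y hy
  · clear hl
    induction l with
    | nil => simp
    | cons a l ih =>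
      simp only [List.map_cons, List.prod_cons] at ih ⊢
      rw [ih]
      group

theorem IsRelatorProduct.inv {m : ℕ} (hu : IsRelatorProduct rels u m) :
    IsRelatorProduct rels u⁻¹ m := by
  obtain ⟨l, rfl, hl, rfl⟩ := hu
  refine ⟨(l.map fun x => (x.1, x.2⁻¹)).reverse, by simp, ?_, ?_⟩
  · intro z hz
    simp only [List.mem_reverse, List.mem_map] at hz
    obtain ⟨y, hy, rfl⟩ := hz
    simpa [or_comm] using hl y hy
  · rw [List.prod_inv_reverse]
    simp [List.map_reverse, Function.comp_def, mul_assoc]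

theorem area_le_of_near (h : Near rels u v k) : (area rels (u * v⁻¹) : ℝ) ≤ k := by
  obtain ⟨n, hn, hk⟩ := h
  exact le_trans (by exact_mod_cast Nat.sInf_le hn) hk

theorem Near.mono (h : Near rels u v k) (hkl : k ≤ l) : Near rels u v l := by
  obtain ⟨n, hn, hk⟩ := h
  exact ⟨n, hn, hk.trans hkl⟩

theorem Near.nonneg (h : Near rels u v k) : 0 ≤ k := by
  obtain ⟨n, -, hk⟩ := h
  exact n.cast_nonneg.trans hk

theorem Near.refl (u : FreeGroup β) (hk : 0 ≤ k) : Near rels u u k :=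
  ⟨0, ⟨[], rfl, by simp, by simp⟩, by simpa using hk⟩

theorem Near.of_mem (h : u * v⁻¹ ∈ rels) : Near rels u v 1 :=
  ⟨1, ⟨[(1, u * v⁻¹)], rfl, by simp [h], by simp⟩, by simp⟩

theorem Near.symm (h : Near rels u v k) : Near rels v u k := by
  obtain ⟨n, hn, hk⟩ := h
  refine ⟨n, ?_, hk⟩
  have := hn.inv
  rwa [mul_inv_rev, inv_inv] at this

theorem Near.trans (h : Near rels u v k) (h' : Near rels v w l) : Near rels u w (k + l) := by
  obtain ⟨n, hn, hk⟩ := h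
  obtain ⟨n', hn', hk'⟩ := h'
  refine ⟨n + n', ?_, by push_cast; linarith⟩
  have := hn.mul hn'
  rwa [show u * v⁻¹ * (v * w⁻¹) = u * w⁻¹ by group] at this

theorem Near.mul_left (h : Near rels u v k) (g : FreeGroup β) :
    Near rels (g * u) (g * v) k := by
  obtain ⟨n, hn, hk⟩ := h
  refine ⟨n, ?_, hk⟩
  have := hn.conj g
  rwa [show g * (u * v⁻¹) * g⁻¹ = g * u * (g * v)⁻¹ by group] at this

theorem Near.mul_right (h : Near rels u v k) (g : FreeGroup β) :
    Near rels (u * g) (v * g) k := by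
  obtain ⟨n, hn, hk⟩ := h
  refine ⟨n, ?_, hk⟩
  rwa [show u * g * (v * g)⁻¹ = u * v⁻¹ by group]

theorem Near.mul (h : Near rels u v k) (h' : Near rels x y l) :
    Near rels (u * x) (v * y) (k + l) :=
  (h.mul_right x).trans (h'.mul_left v)

theorem Near.inv (h : Near rels u v k) : Near rels u⁻¹ v⁻¹ k := by
  have := ((h.mul_left u⁻¹).mul_right v⁻¹).symm
  simpa [mul_assoc] using this

theorem Near.pow (h : Near rels u v k) (n : ℕ) : Near rels (u ^ n) (v ^ n) (n * k) := by
  induction n with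
  | zero => simpa using Near.refl 1 le_rfl
  | succ n ih =>
    rw [pow_succ, pow_succ]
    exact (ih.mul h).mono (by push_cast; linarith)

theorem Near.zpow (h : Near rels u v k) (n : ℤ) :
    Near rels (u ^ n) (v ^ n) (|(n : ℝ)| * k) := by
  obtain ⟨m, rfl | rfl⟩ := n.eq_nat_or_neg
  · simpa using h.pow m
  · simpa using (h.pow m).inv

/-- The commutator of `x ^ m` and `y ^ n` is a product of `|m| |n|` conjugates of the commutator
of `x` and `y`. -/
theorem Near.zpow_mul_zpow_comm (h : Near rels (x * y) (y * x) k) (m n : ℤ) :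
    Near rels (x ^ m * y ^ n) (y ^ n * x ^ m) (|(m : ℝ)| * |(n : ℝ)| * k) := by
  have key : ∀ {x y : FreeGroup β} {k : ℝ} (n : ℤ), Near rels (x * y) (y * x) k →
      Near rels (x * y ^ n) (y ^ n * x) (|(n : ℝ)| * k) := by
    intro x y k n h
    have h1 : Near rels (x * y * x⁻¹) y k := by simpa [mul_assoc] using h.mul_right x⁻¹
    simpa [conj_zpow] using (h1.zpow n).mul_right x
  exact (key m (key n h).symm).symm.mono (by rw [mul_assoc])

/-- Elements `x, y, z` with `x y = z = y x` up to one relator each satisfy `zⁿ = xⁿ yⁿ` up to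
quadratically many relators. -/
theorem Near.zpow_diagonal (h : Near rels (x * y) z 1) (h' : Near rels (y * x) z 1) (n : ℤ) :
    Near rels (z ^ n) (x ^ n * y ^ n) (5 * |(n : ℝ)| * |(n : ℝ)|) := by
  have hc : Near rels (x * y) (y * x) 2 := (h.trans h'.symm).mono (by norm_num)
  have hpow : ∀ m : ℕ, Near rels ((x * y) ^ m) (x ^ m * y ^ m) (2 * m * m) := by
    intro m
    induction m with
    | zero => simpa using Near.refl 1 le_rfl
    | succ m ih =>
      have h2 := ((hc.symm.zpow_mul_zpow_comm m 1).mul_left (x ^ m)).mul_right y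
      have h1 := ih.mul_right (x * y)
      rw [← pow_succ] at h1
      simp only [zpow_natCast, zpow_one, Int.cast_natCast, Int.cast_one, abs_one, Nat.abs_cast,
        mul_one] at h2
      rw [show x ^ (m + 1) * y ^ (m + 1) = x ^ m * (x * y ^ m) * y by
        rw [pow_succ, pow_succ]; group]
      rw [show x ^ m * y ^ m * (x * y) = x ^ m * (y ^ m * x) * y by group] at h1
      refine (h1.trans h2).mono ?_
      push_cast
      nlinarith [(Nat.cast_nonneg m : (0 : ℝ) ≤ m)]
  have hz : Near rels ((x * y) ^ n) (x ^ n * y ^ n) (4 * |(n : ℝ)| * |(n : ℝ)|) := by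
    obtain ⟨m, rfl | rfl⟩ := n.eq_nat_or_neg
    · refine Near.mono (by simpa using hpow m) ?_
      simp only [Int.cast_natCast, Nat.abs_cast]
      nlinarith [(Nat.cast_nonneg m : (0 : ℝ) ≤ m)]
    · have h1 := (hpow m).inv
      rw [mul_inv_rev] at h1
      have h2 := hc.symm.zpow_mul_zpow_comm (-(m : ℤ)) (-(m : ℤ))
      simp only [zpow_neg, zpow_natCast] at h2 ⊢
      refine (h1.trans h2).mono ?_
      push_cast
      simp only [abs_neg, Nat.abs_cast]
      nlinarith [(Nat.cast_nonneg m : (0 : ℝ) ≤ m)]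
  refine ((h.symm.zpow n).trans hz).mono ?_
  have : |(n : ℝ)| ≤ |(n : ℝ)| * |(n : ℝ)| := by
    rcases eq_or_ne n 0 with rfl | hn
    · simp
    · have : (1 : ℝ) ≤ |(n : ℝ)| := by exact_mod_cast Int.one_le_abs hn
      nlinarith
  linarith

end Near

/-! ### Graphs of groups with vertex groups `ℤ × ℤ` and Britton's lemma -/

/-- The three directions in the vertex group `ℤ × ℤ`: the two basis vectors and the diagonal. -/
inductive Dir : Type
  | a | b | d

/-- The vector of a direction. -/
def Dir.vec : Dir → ℤ × ℤ
  | .a => (1, 0)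
  | .b => (0, 1)
  | .d => (1, 1)

/-- A coordinate that takes the value `1` on the vector of the direction. -/
def Dir.coord : Dir → (ℤ × ℤ) →+ ℤ
  | .a => AddMonoidHom.fst ℤ ℤ
  | .b => AddMonoidHom.snd ℤ ℤ
  | .d => AddMonoidHom.fst ℤ ℤ

theorem Dir.coord_vec (x : Dir) : x.coord x.vec = 1 := by cases x <;> rfl

theorem Dir.zsmul_vec_injective (x : Dir) : Function.Injective fun n : ℤ => n • x.vec := by
  intro m n h
  have h' : x.coord (m • x.vec) = x.coord (n • x.vec) := congrArg x.coord h
  rwa [map_zsmul, map_zsmul, coord_vec, smul_eq_mul, smul_eq_mul, mul_one, mul_one] at h'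

/-- A graph of groups with vertex groups `ℤ × ℤ` and infinite cyclic edge groups. `S` is the set
of oriented edges, with reversal `inv`. The edge group of `s` is generated in the vertex group at
`src s` by `pow s` times the direction `dir s`, and in the vertex group at the other end by the
corresponding element for `inv s`. -/
structure PlaneGraph (V S : Type*) where
  /-- The initial vertex. -/
  src : S → V
  /-- The reversed edge. -/
  inv : S → S
  /-- The direction of the edge group in the initial vertex group. -/
  dir : S → Dir
  /-- The multiple of the direction vector that generates the edge group. -/
  pow : S → ℕ
  inv_inv : ∀ s, inv (inv s) = s
  pow_pos : ∀ s, 0 < pow s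

namespace PlaneGraph

variable {V S : Type*} (𝒢 : PlaneGraph V S)

/-- The terminal vertex. -/
def tgt (s : S) : V := 𝒢.src (𝒢.inv s)

/-- The generator of the edge group in the initial vertex group. -/
def unit (s : S) : ℤ × ℤ := (𝒢.pow s : ℤ) • (𝒢.dir s).vec

/-- The coset representatives of the edge group `⟨unit s⟩` are the `g` with `coeff s g = 0`, and
`g - coeff s g • unit s` is the representative of the coset of `g`. -/
def coeff (s : S) (g : ℤ × ℤ) : ℤ := (𝒢.dir s).coord g / 𝒢.pow s

theorem coeff_add (s : S) (n : ℤ) (g : ℤ × ℤ) :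
    𝒢.coeff s (n • 𝒢.unit s + g) = n + 𝒢.coeff s g := by
  have h : (𝒢.pow s : ℤ) ≠ 0 := by exact_mod_cast (𝒢.pow_pos s).ne'
  simp only [coeff, unit, map_add, map_zsmul, Dir.coord_vec, smul_eq_mul, mul_one]
  rw [add_comm, Int.add_mul_ediv_right _ _ h, add_comm]

theorem coeff_zsmul (s : S) (n : ℤ) : 𝒢.coeff s (n • 𝒢.unit s) = n := by
  have := 𝒢.coeff_add s n 0
  rw [add_zero] at this
  rw [this]
  simp [coeff]

/-- The coset representative of `g` modulo the edge group of `s`. -/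
def rep (s : S) (g : ℤ × ℤ) : ℤ × ℤ := g - 𝒢.coeff s g • 𝒢.unit s

theorem coeff_rep (s : S) (g : ℤ × ℤ) : 𝒢.coeff s (𝒢.rep s g) = 0 := by
  have h := 𝒢.coeff_add s (-𝒢.coeff s g) g
  rw [neg_smul, neg_add_eq_sub] at h
  rw [rep, h, neg_add_cancel]

theorem coeff_add_rep (s : S) (g : ℤ × ℤ) : 𝒢.coeff s g • 𝒢.unit s + 𝒢.rep s g = g := by
  simp [rep]

theorem rep_add (s : S) (n : ℤ) (g : ℤ × ℤ) : 𝒢.rep s (n • 𝒢.unit s + g) = 𝒢.rep s g := by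
  rw [rep, coeff_add, rep, add_smul]
  abel

/-- A stack `[(s₁, t₁), (s₂, t₂), …]` stands for the tail `s₁ t₁ s₂ t₂ …` of a normal form: every
`tᵢ` is a coset representative, and there is no pinch `s t s⁻¹` with `t = 0`. -/
def IsNormal : List (S × (ℤ × ℤ)) → Prop
  | [] => True
  | (s, t) :: l => 𝒢.coeff (𝒢.inv s) t = 0 ∧ ¬ (t = 0 ∧ ∃ t' l', l = (𝒢.inv s, t') :: l') ∧
      IsNormal l

open Classical in
/-- Multiplication by the stable letter `s` of the normal form `g s₁ t₁ s₂ t₂ …`. -/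
noncomputable def push (s : S) : (ℤ × ℤ) × List (S × (ℤ × ℤ)) → (ℤ × ℤ) × List (S × (ℤ × ℤ))
  | (g, []) => (𝒢.coeff (𝒢.inv s) g • 𝒢.unit s, [(s, 𝒢.rep (𝒢.inv s) g)])
  | (g, (s', t) :: l) =>
    if 𝒢.rep (𝒢.inv s) g = 0 ∧ s' = 𝒢.inv s then (𝒢.coeff (𝒢.inv s) g • 𝒢.unit s + t, l)
    else (𝒢.coeff (𝒢.inv s) g • 𝒢.unit s, (s, 𝒢.rep (𝒢.inv s) g) :: (s', t) :: l)

variable {𝒢}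

theorem push_of_not {s : S} {g : ℤ × ℤ} {l : List (S × (ℤ × ℤ))}
    (h : ¬ (𝒢.rep (𝒢.inv s) g = 0 ∧ ∃ t' l', l = (𝒢.inv s, t') :: l')) :
    𝒢.push s (g, l) =
      (𝒢.coeff (𝒢.inv s) g • 𝒢.unit s, (s, 𝒢.rep (𝒢.inv s) g) :: l) := by
  rcases l with _ | ⟨⟨s', t⟩, l⟩
  · rfl
  · rw [push, if_neg]
    rintro ⟨h1, rfl⟩
    exact h ⟨h1, _, _, rfl⟩

theorem push_pop {s : S} {g t : ℤ × ℤ} {l : List (S × (ℤ × ℤ))} (h : 𝒢.rep (𝒢.inv s) g = 0) :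
    𝒢.push s (g, (𝒢.inv s, t) :: l) = (𝒢.coeff (𝒢.inv s) g • 𝒢.unit s + t, l) := by
  rw [push, if_pos ⟨h, rfl⟩]

theorem IsNormal.push {s : S} {g : ℤ × ℤ} {l : List (S × (ℤ × ℤ))} (hl : 𝒢.IsNormal l) :
    𝒢.IsNormal (𝒢.push s (g, l)).2 := by
  by_cases h : 𝒢.rep (𝒢.inv s) g = 0 ∧ ∃ t' l', l = (𝒢.inv s, t') :: l'
  · obtain ⟨h, t, l, rfl⟩ := h
    rw [push_pop h]
    exact hl.2.2
  · rw [push_of_not h]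
    exact ⟨𝒢.coeff_rep _ _, h, hl⟩

theorem push_inv_push {s : S} {g : ℤ × ℤ} {l : List (S × (ℤ × ℤ))} (hl : 𝒢.IsNormal l) :
    𝒢.push (𝒢.inv s) (𝒢.push s (g, l)) = (g, l) := by
  by_cases h : 𝒢.rep (𝒢.inv s) g = 0 ∧ ∃ t' l', l = (𝒢.inv s, t') :: l'
  · obtain ⟨h, t, l, rfl⟩ := h
    obtain ⟨h1, h2, -⟩ := hl
    have hg := 𝒢.coeff_add_rep (𝒢.inv s) g
    rw [h, add_zero] at hg
    have ht : 𝒢.rep s t = t := by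
      rw [inv_inv] at h1
      simp [rep, h1]
    rw [push_pop h, push_of_not]
    · rw [inv_inv] at h1
      rw [inv_inv, coeff_add, h1, rep_add, ht, add_zero, hg]
    · simpa only [𝒢.inv_inv, rep_add, ht] using h2
  · have hr : 𝒢.rep s (𝒢.coeff (𝒢.inv s) g • 𝒢.unit s) = 0 := by
      rw [rep, coeff_zsmul, sub_self]
    have hs : 𝒢.push (𝒢.inv s) (𝒢.coeff (𝒢.inv s) g • 𝒢.unit s,
        (𝒢.inv (𝒢.inv s), 𝒢.rep (𝒢.inv s) g) :: l) = (g, l) := by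
      rw [push_pop (by rwa [𝒢.inv_inv]), 𝒢.inv_inv, coeff_zsmul, coeff_add_rep]
    rw [push_of_not h]
    rwa [𝒢.inv_inv] at hs

theorem push_unit_add (s : S) (n : ℤ) (g : ℤ × ℤ) (l : List (S × (ℤ × ℤ))) :
    𝒢.push s (n • 𝒢.unit (𝒢.inv s) + g, l) =
      (n • 𝒢.unit s + (𝒢.push s (g, l)).1, (𝒢.push s (g, l)).2) := by
  by_cases h : 𝒢.rep (𝒢.inv s) g = 0 ∧ ∃ t' l', l = (𝒢.inv s, t') :: l'
  · obtain ⟨h, t, l, rfl⟩ := h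
    rw [push_pop h, push_pop (by rwa [rep_add]), coeff_add, add_smul, add_assoc]
  · rw [push_of_not h, push_of_not (by rwa [rep_add]), coeff_add, rep_add, add_smul]

variable (𝒢)

/-- The normal forms `g s₁ t₁ s₂ t₂ …`. -/
abbrev NormalForm : Type _ := {x : (ℤ × ℤ) × List (S × (ℤ × ℤ)) // 𝒢.IsNormal x.2}

/-- The action of a stable letter on the normal forms. -/
noncomputable def stablePerm (s : S) : Equiv.Perm 𝒢.NormalForm where
  toFun x := ⟨𝒢.push s x.1, IsNormal.push x.2⟩
  invFun x := ⟨𝒢.push (𝒢.inv s) x.1, IsNormal.push x.2⟩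
  left_inv x := Subtype.ext (push_inv_push x.2)
  right_inv x := Subtype.ext (by
    have := push_inv_push (s := 𝒢.inv s) (g := x.1.1) x.2
    rwa [𝒢.inv_inv] at this)

/-- The action of a vertex group on the normal forms. All vertex groups act in the same way. -/
def translation : Multiplicative (ℤ × ℤ) →* Equiv.Perm 𝒢.NormalForm where
  toFun g :=
    { toFun x := ⟨(g.toAdd + x.1.1, x.1.2), x.2⟩
      invFun x := ⟨(-g.toAdd + x.1.1, x.1.2), x.2⟩
      left_inv x := by simp
      right_inv x := by simp }
  map_one' := by ext x : 2; simp
  map_mul' g h := by ext x : 2; simp [add_assoc]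

theorem stablePerm_inv (s : S) : 𝒢.stablePerm (𝒢.inv s) = (𝒢.stablePerm s)⁻¹ := by
  ext1 x
  rfl

theorem stablePerm_mul_translation (s : S) (n : ℤ) :
    𝒢.stablePerm s * 𝒢.translation (.ofAdd (n • 𝒢.unit (𝒢.inv s))) =
      𝒢.translation (.ofAdd (n • 𝒢.unit s)) * 𝒢.stablePerm s := by
  ext1 x
  exact Subtype.ext (push_unit_add s n x.1.1 x.1.2)

theorem translation_injective : Function.Injective 𝒢.translation := by
  intro g h e
  have := congrArg (fun f : Equiv.Perm 𝒢.NormalForm => (f ⟨(0, []), trivial⟩).1.1) e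
  simpa [translation] using this

/-- The steps of a path in the graph of groups: the element `± x` of the vertex group at `v`
(with the sign `+` for `true`), or an edge. -/
inductive Step (V S : Type*) : Type _
  | gen (v : V) (x : Dir) (ε : Bool) : Step V S
  | edge (s : S) : Step V S

/-- The initial vertex of a step. -/
def stepSrc : Step V S → V
  | .gen v _ _ => v
  | .edge s => 𝒢.src s

/-- The terminal vertex of a step. -/
def stepTgt : Step V S → V
  | .gen v _ _ => v
  | .edge s => 𝒢.tgt s

/-- The inverse step. -/
def stepInv : Step V S → Step V S
  | .gen v x ε => .gen v x !ε
  | .edge s => .edge (𝒢.inv s)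

/-- The list of steps `w` is a path from `u` to `v`. -/
def IsPath (u : V) : List (Step V S) → V → Prop
  | [], v => u = v
  | l :: w, v => 𝒢.stepSrc l = u ∧ IsPath (𝒢.stepTgt l) w v

/-- The action of a step on the normal forms. -/
noncomputable def stepPerm : Step V S → Equiv.Perm 𝒢.NormalForm
  | .gen _ x ε => 𝒢.translation (.ofAdd ((if ε then 1 else -1 : ℤ) • x.vec))
  | .edge s => 𝒢.stablePerm s

/-- The action of a path on the normal forms. -/
noncomputable def pathPerm (w : List (Step V S)) : Equiv.Perm 𝒢.NormalForm :=
  (w.map 𝒢.stepPerm).prod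

variable {𝒢}

theorem IsPath.append {u v w : V} {l l' : List (Step V S)} (h : 𝒢.IsPath u l v)
    (h' : 𝒢.IsPath v l' w) : 𝒢.IsPath u (l ++ l') w := by
  induction l generalizing u with
  | nil => cases h; exact h'
  | cons a l ih => exact ⟨h.1, ih h.2⟩

theorem stepPerm_stepInv (a : Step V S) : 𝒢.stepPerm (𝒢.stepInv a) = (𝒢.stepPerm a)⁻¹ := by
  cases a with
  | gen v x ε => cases ε <;> simp [stepPerm, stepInv, ← map_inv, ← ofAdd_neg]
  | edge s => exact 𝒢.stablePerm_inv s

theorem IsPath.reverse {u v : V} {l : List (Step V S)} (h : 𝒢.IsPath u l v) :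
    𝒢.IsPath v (l.map 𝒢.stepInv).reverse u := by
  induction l generalizing u with
  | nil => exact h.symm
  | cons a l ih =>
    obtain ⟨rfl, h⟩ := h
    rw [List.map_cons, List.reverse_cons]
    refine (ih h).append ?_
    cases a with
    | gen v x ε => exact ⟨rfl, rfl⟩
    | edge s => exact ⟨rfl, congrArg 𝒢.src (𝒢.inv_inv s)⟩

theorem pathPerm_append (l l' : List (Step V S)) :
    𝒢.pathPerm (l ++ l') = 𝒢.pathPerm l * 𝒢.pathPerm l' := by
  simp [pathPerm]

theorem pathPerm_reverse (l : List (Step V S)) :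
    𝒢.pathPerm (l.map 𝒢.stepInv).reverse = (𝒢.pathPerm l)⁻¹ := by
  induction l with
  | nil => simp [pathPerm]
  | cons a l ih =>
    rw [List.map_cons, List.reverse_cons, pathPerm_append, ih]
    simp [pathPerm, stepPerm_stepInv]

/-- A property `P v w g` of closed paths `w` at `v` together with an element `g` of the vertex
group at `v` that is stable under concatenation and under conjugation by the edges. -/
structure IsStable (𝒢 : PlaneGraph V S) (P : V → List (Step V S) → ℤ × ℤ → Prop) : Prop where
  nil : ∀ v, P v [] 0
  gen : ∀ v x ε, P v [.gen v x ε] ((if ε then 1 else -1 : ℤ) • x.vec)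
  append : ∀ {v w w' g g'}, P v w g → P v w' g' → P v (w ++ w') (g + g')
  conj : ∀ {s w} {n : ℤ}, P (𝒢.tgt s) w (n • 𝒢.unit (𝒢.inv s)) →
    P (𝒢.src s) (.edge s :: w ++ [.edge (𝒢.inv s)]) (n • 𝒢.unit s)

/-- The path `w` starting at `v` splits along the normal form `g s₁ t₁ s₂ t₂ …`: it is
`w₀ s₁ w₁ s₂ …`, where every `wᵢ` is a closed path that has, with a suitable element of the vertex
group, the property `P`. -/
def Splits (𝒢 : PlaneGraph V S) (P : V → List (Step V S) → ℤ × ℤ → Prop) :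
    V → List (Step V S) → ℤ × ℤ → List (S × (ℤ × ℤ)) → Prop
  | v, w, g, [] => P v w g
  | v, w, g, (s, t) :: l => ∃ (u w' : List (Step V S)) (n : ℤ), w = u ++ .edge s :: w' ∧
      v = 𝒢.src s ∧ P v u (g - n • 𝒢.unit s) ∧
      Splits 𝒢 P (𝒢.tgt s) w' (n • 𝒢.unit (𝒢.inv s) + t) l

section Britton

variable {P : V → List (Step V S) → ℤ × ℤ → Prop}

theorem Splits.append (hP : IsStable 𝒢 P) {v : V} {u w : List (Step V S)} {g h : ℤ × ℤ}
    {l : List (S × (ℤ × ℤ))} (hu : P v u h) (hw : Splits 𝒢 P v w g l) :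
    Splits 𝒢 P v (u ++ w) (h + g) l := by
  rcases l with _ | ⟨⟨s, t⟩, l⟩
  · exact hP.append hu hw
  · obtain ⟨u', w', n, rfl, rfl, h1, h2⟩ := hw
    refine ⟨u ++ u', w', n, by simp, rfl, ?_, h2⟩
    rw [add_sub_assoc]
    exact hP.append hu h1

theorem Splits.edge (hP : IsStable 𝒢 P) {s : S} {w : List (Step V S)} {g : ℤ × ℤ}
    {l : List (S × (ℤ × ℤ))} (hw : Splits 𝒢 P (𝒢.tgt s) w g l) :
    Splits 𝒢 P (𝒢.src s) (.edge s :: w) (𝒢.push s (g, l)).1 (𝒢.push s (g, l)).2 := by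
  by_cases h : 𝒢.rep (𝒢.inv s) g = 0 ∧ ∃ t' l', l = (𝒢.inv s, t') :: l'
  · obtain ⟨h, t, l, rfl⟩ := h
    rw [push_pop h]
    obtain ⟨u, w, n, rfl, -, h1, h2⟩ := hw
    have hg := 𝒢.coeff_add_rep (𝒢.inv s) g
    rw [h, add_zero] at hg
    rw [← hg, ← sub_smul] at h1
    rw [tgt, 𝒢.inv_inv] at h2
    have h3 := Splits.append hP (hP.conj h1) h2
    rw [← add_assoc, ← add_smul, sub_add_cancel] at h3
    simpa using h3
  · rw [push_of_not h]
    refine ⟨[], w, 𝒢.coeff (𝒢.inv s) g, rfl, rfl, ?_, ?_⟩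
    · rw [sub_self]
      exact hP.nil _
    · rwa [coeff_add_rep]

theorem splits_of_isPath (hP : IsStable 𝒢 P) {u v : V} {w : List (Step V S)}
    (hw : 𝒢.IsPath u w v) :
    Splits 𝒢 P u w (𝒢.pathPerm w ⟨(0, []), trivial⟩).1.1
      (𝒢.pathPerm w ⟨(0, []), trivial⟩).1.2 := by
  induction w generalizing u with
  | nil => exact hP.nil u
  | cons a w ih =>
    obtain ⟨rfl, hw⟩ := hw
    have := ih hw
    cases a with
    | gen v x ε => exact Splits.append hP (hP.gen v x ε) this
    | edge s => exact Splits.edge hP this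

/-- Britton's lemma: a closed path that acts on the normal forms like the element `g` of the
vertex group reduces to `g` by removing pinches, so that every stable property holds for it. -/
theorem IsStable.of_pathPerm_eq (hP : IsStable 𝒢 P) {v : V} {w : List (Step V S)} {g : ℤ × ℤ}
    (hw : 𝒢.IsPath v w v) (hg : 𝒢.pathPerm w = 𝒢.translation (.ofAdd g)) : P v w g := by
  have := splits_of_isPath hP hw
  rw [hg] at this
  simpa [translation, Splits] using this

end Britton

end PlaneGraph

/-! ### Distortion and area of paths -/

namespace PlaneGraph

variable {V S β : Type*} {𝒢 : PlaneGraph V S} {rels : Set (FreeGroup β)} {θ : ℝ}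

/-- A realization of the graph of groups by words over the presentation with relators `rels`: the
relations that define its fundamental groupoid hold at the cost of one relator each. -/
structure Realization (𝒢 : PlaneGraph V S) (rels : Set (FreeGroup β)) where
  /-- The word for a direction of a vertex group. -/
  gen : V → Dir → FreeGroup β
  /-- The word for an edge. -/
  stable : S → FreeGroup β
  near_ab : ∀ v, Near rels (gen v .a * gen v .b) (gen v .d) 1
  near_ba : ∀ v, Near rels (gen v .b * gen v .a) (gen v .d) 1
  stable_inv : ∀ s, stable (𝒢.inv s) = (stable s)⁻¹
  near_edge : ∀ s, Near rels
    (stable s * gen (𝒢.tgt s) (𝒢.dir (𝒢.inv s)) ^ 𝒢.pow (𝒢.inv s) * (stable s)⁻¹)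
    (gen (𝒢.src s) (𝒢.dir s) ^ 𝒢.pow s) 1

namespace Realization

variable (ρ : 𝒢.Realization rels)

/-- The word of a step. -/
def evalStep : Step V S → FreeGroup β
  | .gen v x ε => ρ.gen v x ^ (if ε then 1 else -1 : ℤ)
  | .edge s => ρ.stable s

/-- The word of a path. -/
def eval (w : List (Step V S)) : FreeGroup β := (w.map ρ.evalStep).prod

theorem eval_append (w w' : List (Step V S)) : ρ.eval (w ++ w') = ρ.eval w * ρ.eval w' := by
  simp [eval]

theorem evalStep_stepInv (a : Step V S) : ρ.evalStep (𝒢.stepInv a) = (ρ.evalStep a)⁻¹ := by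
  cases a with
  | gen v x ε => cases ε <;> simp [evalStep, stepInv]
  | edge s => exact ρ.stable_inv s

theorem eval_reverse (w : List (Step V S)) :
    ρ.eval (w.map 𝒢.stepInv).reverse = (ρ.eval w)⁻¹ := by
  induction w with
  | nil => simp [eval]
  | cons a l ih =>
    rw [List.map_cons, List.reverse_cons, eval_append, ih]
    simp [eval, evalStep_stepInv]

/-- The normal form of the element `A a + B b + D d` of a vertex group. -/
def collected (v : V) (A B D : ℤ) : FreeGroup β :=
  ρ.gen v .a ^ A * ρ.gen v .b ^ B * ρ.gen v .d ^ D

theorem near_ab_comm (v : V) : Near rels (ρ.gen v .a * ρ.gen v .b) (ρ.gen v .b * ρ.gen v .a) 2 :=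
  ((ρ.near_ab v).trans (ρ.near_ba v).symm).mono (by norm_num)

theorem near_ad_comm (v : V) : Near rels (ρ.gen v .a * ρ.gen v .d) (ρ.gen v .d * ρ.gen v .a) 2 := by
  have h1 := (ρ.near_ba v).symm.mul_left (ρ.gen v .a)
  have h2 := (ρ.near_ab v).mul_right (ρ.gen v .a)
  rw [← mul_assoc] at h1
  exact (h1.trans h2).mono (by norm_num)

theorem near_bd_comm (v : V) : Near rels (ρ.gen v .b * ρ.gen v .d) (ρ.gen v .d * ρ.gen v .b) 2 := by
  have h1 := (ρ.near_ab v).symm.mul_left (ρ.gen v .b)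
  have h2 := (ρ.near_ba v).mul_right (ρ.gen v .b)
  rw [← mul_assoc] at h1
  exact (h1.trans h2).mono (by norm_num)

/-- Only pairs of different directions contribute to the cost of a product of normal forms. -/
theorem near_collected_mul (v : V) (A B D A' B' D' : ℤ) :
    Near rels (ρ.collected v A B D * ρ.collected v A' B' D')
      (ρ.collected v (A + A') (B + B') (D + D'))
      (2 * (|(A' : ℝ)| * |(B : ℝ)| + |(A' : ℝ)| * |(D : ℝ)| + |(B' : ℝ)| * |(D : ℝ)|)) := by
  simp only [collected]
  set a := ρ.gen v .a
  set b := ρ.gen v .b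
  set d := ρ.gen v .d
  have h1 : Near rels (d ^ D * a ^ A') (a ^ A' * d ^ D) _ :=
    (ρ.near_ad_comm v).symm.zpow_mul_zpow_comm D A'
  have h2 : Near rels (b ^ B * a ^ A') (a ^ A' * b ^ B) _ :=
    (ρ.near_ab_comm v).symm.zpow_mul_zpow_comm B A'
  have h3 : Near rels (d ^ D * b ^ B') (b ^ B' * d ^ D) _ :=
    (ρ.near_bd_comm v).symm.zpow_mul_zpow_comm D B'
  have h1' := (h1.mul_left (a ^ A * b ^ B)).mul_right (b ^ B' * d ^ D')
  have h2' := (h2.mul_left (a ^ A)).mul_right (d ^ D * (b ^ B' * d ^ D'))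
  have h3' := (h3.mul_left (a ^ A * a ^ A' * b ^ B)).mul_right (d ^ D')
  simp only [zpow_add, mul_assoc] at h1' h2' h3' ⊢
  exact (h1'.trans (h2'.trans h3')).mono (by linarith)

/-- If `A a + B b + D d` is a multiple of one direction, then two of the coefficients have the same
absolute value, and only pairs of different directions contribute to the cost. -/
theorem near_collected_zpow (v : V) {A B D N : ℤ} (x : Dir)
    (h : ((A + D, B + D) : ℤ × ℤ) = N • x.vec) :
    Near rels (ρ.collected v A B D) (ρ.gen v x ^ N)
      (5 * (|(A : ℝ)| * |(B : ℝ)| + |(A : ℝ)| * |(D : ℝ)| + |(B : ℝ)| * |(D : ℝ)|)) := by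
  have hAB := mul_nonneg (abs_nonneg (A : ℝ)) (abs_nonneg (B : ℝ))
  have hAD := mul_nonneg (abs_nonneg (A : ℝ)) (abs_nonneg (D : ℝ))
  have hBD := mul_nonneg (abs_nonneg (B : ℝ)) (abs_nonneg (D : ℝ))
  cases x with
  | a =>
    simp only [Dir.vec, Prod.smul_mk, smul_eq_mul, mul_one, mul_zero, Prod.mk.injEq] at h
    obtain ⟨rfl, h⟩ := h
    obtain rfl : B = -D := by omega
    have h1 := ((ρ.near_ba v).zpow_diagonal (ρ.near_ab v) D).mul_left
      (ρ.gen v .a ^ A * ρ.gen v .b ^ (-D))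
    rw [show ρ.gen v .a ^ A * ρ.gen v .b ^ (-D) * (ρ.gen v .b ^ D * ρ.gen v .a ^ D) =
      ρ.gen v .a ^ (A + D) by rw [zpow_add]; group] at h1
    refine h1.mono ?_
    push_cast at hAB hAD hBD ⊢
    rw [abs_neg] at *
    linarith
  | b =>
    simp only [Dir.vec, Prod.smul_mk, smul_eq_mul, mul_one, mul_zero, Prod.mk.injEq] at h
    obtain ⟨h, rfl⟩ := h
    obtain rfl : A = -D := by omega
    have h1 := ((ρ.near_bd_comm v).zpow_mul_zpow_comm B D).mul_left (ρ.gen v .a ^ (-D))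
    have h2 := (((ρ.near_ab v).zpow_diagonal (ρ.near_ba v) D).mul_left
      (ρ.gen v .a ^ (-D))).mul_right (ρ.gen v .b ^ B)
    rw [← mul_assoc, ← mul_assoc] at h1
    rw [show ρ.gen v .a ^ (-D) * (ρ.gen v .a ^ D * ρ.gen v .b ^ D) * ρ.gen v .b ^ B =
      ρ.gen v .b ^ (B + D) by rw [add_comm, zpow_add]; group] at h2
    refine (h1.trans h2).mono ?_
    push_cast at hAB hAD hBD ⊢
    rw [abs_neg] at *
    linarith
  | d =>
    simp only [Dir.vec, Prod.smul_mk, smul_eq_mul, mul_one, Prod.mk.injEq] at h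
    obtain ⟨rfl, h⟩ := h
    obtain rfl : B = A := by omega
    have h1 := ((ρ.near_ab v).zpow_diagonal (ρ.near_ba v) B).symm.mul_right (ρ.gen v .d ^ D)
    rw [← zpow_add] at h1
    exact h1.mono (by linarith)

theorem near_edge_zpow (s : S) (n : ℤ) : Near rels
    (ρ.stable s * ρ.gen (𝒢.tgt s) (𝒢.dir (𝒢.inv s)) ^ (n * 𝒢.pow (𝒢.inv s)) * (ρ.stable s)⁻¹)
    (ρ.gen (𝒢.src s) (𝒢.dir s) ^ (n * 𝒢.pow s)) |(n : ℝ)| := by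
  have := (ρ.near_edge s).zpow n
  rw [conj_zpow, ← zpow_natCast, ← zpow_natCast, ← zpow_mul, ← zpow_mul, mul_one] at this
  rwa [mul_comm n, mul_comm n]

end Realization

/-- Weights of the directions: `weight v x * |N| ^ (1 / θ)` will be a lower bound for the length of
the paths that represent `N` times the direction `x` at `v`. -/
structure Weighting (𝒢 : PlaneGraph V S) (θ : ℝ) where
  /-- The weight of a direction. -/
  weight : V → Dir → ℝ
  pos : ∀ v x, 0 < weight v x
  le_one : ∀ v x, weight v x ≤ 1
  a_le_d : ∀ v, weight v .a ≤ weight v .d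
  b_le_d : ∀ v, weight v .b ≤ weight v .d
  d_le : ∀ v, weight v .d ≤ weight v .a + weight v .b
  edge : ∀ s, weight (𝒢.src s) (𝒢.dir s) * (𝒢.pow s : ℝ) ^ (1 / θ) =
    weight (𝒢.tgt s) (𝒢.dir (𝒢.inv s)) * (𝒢.pow (𝒢.inv s) : ℝ) ^ (1 / θ)

/-- The number of relators, up to a factor, for collecting pieces of total lengths `x`, `y`, `z` in
the three directions. -/
noncomputable def collectingCost (θ x y z : ℝ) : ℝ :=
  (x ^ θ) ^ 2 + (y ^ θ) ^ 2 + (z ^ θ) ^ 2 + x ^ θ * y ^ θ + x ^ θ * z ^ θ + y ^ θ * z ^ θ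

/-- The path `w` at `v` has the value `g = A a + B b + D d`, the length of `w` is distributed over
the three directions such that the coefficients obey the distortion estimate for these lengths, and
the collection of `w` to its normal form costs at most `E * collectingCost`. -/
def Collectible (ρ : 𝒢.Realization rels) (ω : 𝒢.Weighting θ) (E : ℝ) (v : V)
    (w : List (Step V S)) (g : ℤ × ℤ) : Prop :=
  ∃ (A B D : ℤ) (x y z : ℝ), 0 ≤ x ∧ 0 ≤ y ∧ 0 ≤ z ∧ x + y + z = w.length ∧ g = (A + D, B + D) ∧
    ω.weight v .a * |(A : ℝ)| ^ (1 / θ) ≤ x ∧ ω.weight v .b * |(B : ℝ)| ^ (1 / θ) ≤ y ∧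
    ω.weight v .d * |(D : ℝ)| ^ (1 / θ) ≤ z ∧
    Near rels (ρ.eval w) (ρ.collected v A B D) (E * collectingCost θ x y z)

theorem abs_add_rpow_le (hθ : 1 ≤ θ) (x y : ℝ) :
    |x + y| ^ (1 / θ) ≤ |x| ^ (1 / θ) + |y| ^ (1 / θ) := by
  have h0 : 0 < θ := by linarith
  refine (Real.rpow_le_rpow (abs_nonneg _) (abs_add_le x y) (by positivity)).trans ?_
  exact Real.rpow_add_le_add_rpow (abs_nonneg _) (abs_nonneg _) (by positivity)
    (by rw [div_le_one h0]; exact hθ)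

theorem Weighting.abs_add_le (ω : 𝒢.Weighting θ) (hθ : 1 ≤ θ) {v : V} {x : Dir} {s t M N : ℝ}
    (hs : ω.weight v x * |M| ^ (1 / θ) ≤ s) (ht : ω.weight v x * |N| ^ (1 / θ) ≤ t) :
    ω.weight v x * |M + N| ^ (1 / θ) ≤ s + t := by
  have := mul_le_mul_of_nonneg_left (abs_add_rpow_le hθ M N) (ω.pos v x).le
  linarith

/-- The estimate by the weights, solved for the exponent. -/
theorem Weighting.abs_le (ω : 𝒢.Weighting θ) (hθ : 1 ≤ θ) {κ : ℝ}
    (hκ : ∀ v x, (ω.weight v x)⁻¹ ^ θ ≤ κ) {v : V} {x : Dir} {N t : ℝ}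
    (h : ω.weight v x * |N| ^ (1 / θ) ≤ t) : |N| ≤ κ * t ^ θ := by
  have h0 : 0 < θ := by linarith
  have hω := ω.pos v x
  have ht : 0 ≤ t := le_trans (by positivity) h
  calc |N| = (|N| ^ (1 / θ)) ^ θ := by
        rw [← Real.rpow_mul (abs_nonneg _), one_div_mul_cancel h0.ne', Real.rpow_one]
    _ ≤ ((ω.weight v x)⁻¹ * t) ^ θ := by
        refine Real.rpow_le_rpow (by positivity) ?_ h0.le
        rw [← div_eq_inv_mul, le_div_iff₀ hω]
        linarith
    _ = (ω.weight v x)⁻¹ ^ θ * t ^ θ := Real.mul_rpow (by positivity) ht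
    _ ≤ κ * t ^ θ := by
        have := hκ v x
        gcongr

theorem collectingCost_add_le (hθ : 1 ≤ θ) {x y z x' y' z' : ℝ} (hx : 0 ≤ x) (hy : 0 ≤ y)
    (hz : 0 ≤ z) (hx' : 0 ≤ x') (hy' : 0 ≤ y') (hz' : 0 ≤ z') :
    collectingCost θ x y z + collectingCost θ x' y' z' +
        (x' ^ θ * y ^ θ + x' ^ θ * z ^ θ + y' ^ θ * z ^ θ) ≤
      collectingCost θ (x + x') (y + y') (z + z') := by
  have h1 := Real.add_rpow_le_rpow_add hx hx' hθ
  have h2 := Real.add_rpow_le_rpow_add hy hy' hθ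
  have h3 := Real.add_rpow_le_rpow_add hz hz' hθ
  have p1 := Real.rpow_nonneg hx θ
  have p2 := Real.rpow_nonneg hy θ
  have p3 := Real.rpow_nonneg hz θ
  have q1 := Real.rpow_nonneg hx' θ
  have q2 := Real.rpow_nonneg hy' θ
  have q3 := Real.rpow_nonneg hz' θ
  simp only [collectingCost]
  generalize x ^ θ = X, y ^ θ = Y, z ^ θ = Z, x' ^ θ = X', y' ^ θ = Y', z' ^ θ = Z',
    (x + x') ^ θ = U, (y + y') ^ θ = W, (z + z') ^ θ = T at *
  calc _ ≤ (X + X') ^ 2 + (Y + Y') ^ 2 + (Z + Z') ^ 2 + (X + X') * (Y + Y') +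
        (X + X') * (Z + Z') + (Y + Y') * (Z + Z') := by
        have := mul_nonneg p1 q1
        have := mul_nonneg p2 q2
        have := mul_nonneg p3 q3
        have := mul_nonneg p1 q2
        have := mul_nonneg p1 q3
        have := mul_nonneg p2 q3
        linarith
    _ ≤ _ := by
        have : 0 ≤ U := (add_nonneg p1 q1).trans h1
        have : 0 ≤ W := (add_nonneg p2 q2).trans h2
        gcongr

theorem collectingCost_add_pairs_le (hθ : 1 ≤ θ) {x y z : ℝ} (hx : 0 ≤ x) (hy : 0 ≤ y)
    (hz : 0 ≤ z) :
    collectingCost θ x y z + (x ^ θ * y ^ θ + x ^ θ * z ^ θ + y ^ θ * z ^ θ) ≤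
      ((x + y + z) ^ θ) ^ 2 := by
  have h1 := Real.add_rpow_le_rpow_add hx hy hθ
  have h2 := Real.add_rpow_le_rpow_add (add_nonneg hx hy) hz hθ
  have p1 := Real.rpow_nonneg hx θ
  have p2 := Real.rpow_nonneg hy θ
  have p3 := Real.rpow_nonneg hz θ
  calc _ = (x ^ θ + y ^ θ + z ^ θ) ^ 2 := by simp only [collectingCost]; ring
    _ ≤ _ := by gcongr; linarith

section Collectible

variable (ρ : 𝒢.Realization rels) (ω : 𝒢.Weighting θ) {κ E : ℝ}

theorem Weighting.pairs_le (hθ : 1 ≤ θ) (hκ : ∀ v x, (ω.weight v x)⁻¹ ^ θ ≤ κ)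
    {v v' : V} {x x' : Dir} {M N s t : ℝ}
    (hs : ω.weight v x * |M| ^ (1 / θ) ≤ s) (ht : ω.weight v' x' * |N| ^ (1 / θ) ≤ t) :
    |M| * |N| ≤ κ ^ 2 * (s ^ θ * t ^ θ) := by
  have h1 := ω.abs_le hθ hκ hs
  have h2 := ω.abs_le hθ hκ ht
  calc |M| * |N| ≤ (κ * s ^ θ) * (κ * t ^ θ) :=
        mul_le_mul h1 h2 (abs_nonneg _) ((abs_nonneg _).trans h1)
    _ = _ := by ring

variable {ρ ω}

/-- The commutation of the directions is paid for by the cross terms of `collectingCost`. -/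
theorem Collectible.append (hθ : 1 ≤ θ) (hκ : ∀ v x, (ω.weight v x)⁻¹ ^ θ ≤ κ)
    (hE : 5 * κ ^ 2 ≤ E) {v : V} {w w' : List (Step V S)} {g g' : ℤ × ℤ}
    (h : Collectible ρ ω E v w g) (h' : Collectible ρ ω E v w' g') :
    Collectible ρ ω E v (w ++ w') (g + g') := by
  obtain ⟨A, B, D, x, y, z, hx, hy, hz, hl, rfl, hA, hB, hD, hn⟩ := h
  obtain ⟨A', B', D', x', y', z', hx', hy', hz', hl', rfl, hA', hB', hD', hn'⟩ := h'
  refine ⟨A + A', B + B', D + D', x + x', y + y', z + z', by positivity, by positivity,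
    by positivity, ?_, ?_, ?_, ?_, ?_, ?_⟩
  · rw [List.length_append, Nat.cast_add, ← hl, ← hl']
    ring
  · ext <;> simp <;> ring
  · push_cast
    exact ω.abs_add_le hθ hA hA'
  · push_cast
    exact ω.abs_add_le hθ hB hB'
  · push_cast
    exact ω.abs_add_le hθ hD hD'
  · rw [ρ.eval_append]
    refine ((hn.mul hn').trans (ρ.near_collected_mul v A B D A' B' D')).mono ?_
    have h1 := ω.pairs_le hθ hκ hA' hB
    have h2 := ω.pairs_le hθ hκ hA' hD
    have h3 := ω.pairs_le hθ hκ hB' hD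
    have h4 : (0 : ℝ) ≤ x' ^ θ * y ^ θ + x' ^ θ * z ^ θ + y' ^ θ * z ^ θ := by positivity
    have hE0 : 0 ≤ E := le_trans (by positivity) hE
    have h5 := mul_le_mul_of_nonneg_left (collectingCost_add_le hθ hx hy hz hx' hy' hz') hE0
    have h6 := mul_le_mul_of_nonneg_right hE h4
    have h7 := mul_nonneg (sq_nonneg κ) h4
    linarith

/-- A path that represents a power of a direction has its area bounded with the constant `E`
itself. -/
theorem Collectible.near_zpow (hθ : 1 ≤ θ) (hκ : ∀ v x, (ω.weight v x)⁻¹ ^ θ ≤ κ)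
    (hE : 5 * κ ^ 2 ≤ E) {v : V} {w : List (Step V S)} {x : Dir} {N : ℤ}
    (h : Collectible ρ ω E v w (N • x.vec)) :
    Near rels (ρ.eval w) (ρ.gen v x ^ N) (E * ((w.length : ℝ) ^ θ) ^ 2) := by
  obtain ⟨A, B, D, r, s, t, hr, hs, ht, hl, hg, hA, hB, hD, hn⟩ := h
  refine (hn.trans (ρ.near_collected_zpow v x hg.symm)).mono ?_
  have h1 := ω.pairs_le hθ hκ hA hB
  have h2 := ω.pairs_le hθ hκ hA hD
  have h3 := ω.pairs_le hθ hκ hB hD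
  have h4 : (0 : ℝ) ≤ r ^ θ * s ^ θ + r ^ θ * t ^ θ + s ^ θ * t ^ θ := by positivity
  have hE0 : 0 ≤ E := le_trans (by positivity) hE
  have h5 := mul_le_mul_of_nonneg_left (collectingCost_add_pairs_le hθ hr hs ht) hE0
  have h6 := mul_le_mul_of_nonneg_right hE h4
  rw [← hl]
  linarith

/-- The distortion estimate: a path that represents `N` times a direction has length at least the
weight of the direction times `|N| ^ (1 / θ)`. -/
theorem Collectible.weight_mul_le (hθ : 1 ≤ θ) {v : V} {w : List (Step V S)} {x : Dir} {N : ℤ}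
    (h : Collectible ρ ω E v w (N • x.vec)) :
    ω.weight v x * |(N : ℝ)| ^ (1 / θ) ≤ w.length := by
  obtain ⟨A, B, D, r, s, t, hr, hs, ht, hl, hg, hA, hB, hD, -⟩ := h
  rw [← hl]
  have hD0 : 0 ≤ |(D : ℝ)| ^ (1 / θ) := by positivity
  cases x with
  | a =>
    simp only [Dir.vec, Prod.smul_mk, smul_eq_mul, mul_one, mul_zero, Prod.mk.injEq] at hg
    obtain ⟨rfl, -⟩ := hg
    have := ω.abs_add_le hθ hA ((mul_le_mul_of_nonneg_right (ω.a_le_d v) hD0).trans hD)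
    push_cast
    linarith
  | b =>
    simp only [Dir.vec, Prod.smul_mk, smul_eq_mul, mul_one, mul_zero, Prod.mk.injEq] at hg
    obtain ⟨-, rfl⟩ := hg
    have := ω.abs_add_le hθ hB ((mul_le_mul_of_nonneg_right (ω.b_le_d v) hD0).trans hD)
    push_cast
    linarith
  | d =>
    simp only [Dir.vec, Prod.smul_mk, smul_eq_mul, mul_one, Prod.mk.injEq] at hg
    obtain ⟨rfl, hg⟩ := hg
    obtain rfl : B = A := by omega
    have h1 : ω.weight v .d * |(B : ℝ)| ^ (1 / θ) ≤ r + s := by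
      have := mul_le_mul_of_nonneg_right (ω.d_le v)
        (Real.rpow_nonneg (abs_nonneg (B : ℝ)) (1 / θ))
      linarith
    have := ω.abs_add_le hθ h1 hD
    push_cast
    linarith

/-- A path that represents `N` times a direction can be regarded as a single piece in this
direction. -/
theorem Collectible.of_near (hθ : 1 ≤ θ) {v : V} {w : List (Step V S)} (x : Dir) {N : ℤ}
    (h : ω.weight v x * |(N : ℝ)| ^ (1 / θ) ≤ w.length)
    (hn : Near rels (ρ.eval w) (ρ.gen v x ^ N) (E * ((w.length : ℝ) ^ θ) ^ 2)) :
    Collectible ρ ω E v w (N • x.vec) := by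
  have h0 : θ ≠ 0 := by linarith
  have h1 : θ⁻¹ ≠ 0 := inv_ne_zero h0
  cases x with
  | a =>
    refine ⟨N, 0, 0, w.length, 0, 0, by positivity, le_rfl, le_rfl, by ring, by simp [Dir.vec], h,
      by simp [Real.zero_rpow h1], by simp [Real.zero_rpow h1], ?_⟩
    simpa [Realization.collected, collectingCost, Real.zero_rpow h0] using hn
  | b =>
    refine ⟨0, N, 0, 0, w.length, 0, le_rfl, by positivity, le_rfl, by ring, by simp [Dir.vec],
      by simp [Real.zero_rpow h1], h, by simp [Real.zero_rpow h1], ?_⟩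
    simpa [Realization.collected, collectingCost, Real.zero_rpow h0] using hn
  | d =>
    refine ⟨0, 0, N, 0, 0, w.length, le_rfl, le_rfl, by positivity, by ring, by simp [Dir.vec],
      by simp [Real.zero_rpow h1], by simp [Real.zero_rpow h1], h, ?_⟩
    simpa [Realization.collected, collectingCost, Real.zero_rpow h0] using hn

theorem Collectible.conj (hθ : 1 ≤ θ) (hκ : ∀ v x, (ω.weight v x)⁻¹ ^ θ ≤ κ)
    (hE : 5 * κ ^ 2 ≤ E) {s : S} {w : List (Step V S)} {n : ℤ}
    (h : Collectible ρ ω E (𝒢.tgt s) w (n • 𝒢.unit (𝒢.inv s))) :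
    Collectible ρ ω E (𝒢.src s) (.edge s :: w ++ [.edge (𝒢.inv s)]) (n • 𝒢.unit s) := by
  have hlen : ((Step.edge s :: w ++ [Step.edge (𝒢.inv s)]).length : ℝ) = w.length + 2 := by
    simp
    ring
  rw [unit, smul_smul] at h ⊢
  have hn := h.near_zpow hθ hκ hE
  have hd := h.weight_mul_le hθ
  have habs : ∀ k : ℕ, |((n * (k : ℤ) : ℤ) : ℝ)| ^ (1 / θ) =
      (k : ℝ) ^ (1 / θ) * |(n : ℝ)| ^ (1 / θ) := by
    intro k
    push_cast
    rw [abs_mul, Nat.abs_cast, mul_comm, Real.mul_rpow (by positivity) (by positivity)]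
  refine Collectible.of_near hθ _ ?_ ?_
  · rw [hlen, habs, ← mul_assoc, ω.edge, mul_assoc, ← habs]
    linarith
  · rw [hlen]
    have h1 : ρ.eval (.edge s :: w ++ [.edge (𝒢.inv s)]) =
        ρ.stable s * ρ.eval w * (ρ.stable s)⁻¹ := by
      simp [Realization.eval, Realization.evalStep, ρ.stable_inv, mul_assoc]
    rw [h1]
    refine (((hn.mul_left _).mul_right _).trans (ρ.near_edge_zpow s n)).mono ?_
    -- `|n|` is at most `κ |w| ^ θ`, and this is the gain from the two additional edges.
    have hκ1 : 1 ≤ κ := by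
      refine le_trans ?_ (hκ (𝒢.src s) .a)
      exact Real.one_le_rpow ((one_le_inv₀ (ω.pos _ _)).mpr (ω.le_one _ _)) (by linarith)
    have h2 : |(n : ℝ)| ≤ κ * (w.length : ℝ) ^ θ := by
      refine le_trans ?_ (ω.abs_le hθ hκ hd)
      push_cast
      rw [abs_mul, Nat.abs_cast]
      have : (1 : ℝ) ≤ 𝒢.pow (𝒢.inv s) := by exact_mod_cast 𝒢.pow_pos _
      nlinarith [abs_nonneg (n : ℝ)]
    have h3 := Real.add_rpow_le_rpow_add (Nat.cast_nonneg w.length : (0 : ℝ) ≤ _)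
      (by norm_num : (0 : ℝ) ≤ 2) hθ
    have h4 : (1 : ℝ) ≤ 2 ^ θ := Real.one_le_rpow (by norm_num) (by linarith)
    have h5 : (0 : ℝ) ≤ (w.length : ℝ) ^ θ := by positivity
    generalize (w.length : ℝ) ^ θ = X at *
    have hκE : κ ≤ E := by nlinarith
    calc E * X ^ 2 + |(n : ℝ)| ≤ E * X ^ 2 + E * X := by
          have := mul_le_mul_of_nonneg_right hκE h5
          linarith
      _ ≤ E * (X + 1) ^ 2 := by nlinarith
      _ ≤ _ := by
          have : 0 ≤ E := by linarith
          gcongr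
          linarith

theorem isStable_collectible (hθ : 1 ≤ θ) (hκ : ∀ v x, (ω.weight v x)⁻¹ ^ θ ≤ κ)
    (hE : 5 * κ ^ 2 ≤ E) : IsStable 𝒢 (Collectible ρ ω E) where
  nil v := by
    have h0 : θ ≠ 0 := by linarith
    have h := Collectible.of_near (ρ := ρ) (ω := ω) (E := E) hθ (v := v) (w := []) .a (N := 0)
      (by simp [Real.zero_rpow (inv_ne_zero h0)])
      (by simpa [Realization.eval, Real.zero_rpow h0] using Near.refl 1 le_rfl)
    simpa using h
  gen v x ε := by
    have hE0 : 0 ≤ E := le_trans (by positivity) hE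
    refine Collectible.of_near hθ x ?_ ?_
    · cases ε <;> simpa using ω.le_one v x
    · simpa [Realization.eval, Realization.evalStep] using Near.refl _ hE0
  append := Collectible.append hθ hκ hE
  conj := Collectible.conj hθ hκ hE

end Collectible

end PlaneGraph

/-! ### The decomposition of `G_{r,P}` into copies of `ℤ × ℤ` -/

/-- On a tree, a function on the oriented edges with values in a group, that takes inverse values
on an edge and its reverse, is the coboundary of a function on the vertices. -/
theorem exists_potential_of_isTree {V M : Type*} [Group M] {H : SimpleGraph V} (hH : H.IsTree)
    (f : V → V → M) (hf : ∀ u v, H.Adj u v → f v u = (f u v)⁻¹) :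
    ∃ Γ : V → M, ∀ u v, H.Adj u v → Γ v = Γ u * f u v := by
  classical
  obtain ⟨r⟩ := hH.connected.nonempty
  choose p hp using fun v => (hH.existsUnique_path r v).exists
  refine ⟨fun v => ((p v).darts.map fun d => f d.fst d.snd).prod, ?_⟩
  have key : ∀ u v, H.Adj u v → u ∈ (p v).support →
      ((p v).darts.map fun d => f d.fst d.snd).prod =
        ((p u).darts.map fun d => f d.fst d.snd).prod * f u v := by
    intro u v h hu
    rw [hH.isAcyclic.path_concat (hp u) (hp v) h hu]
    simp [SimpleGraph.Walk.darts_concat]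
  intro u v h
  by_cases hu : u ∈ (p v).support
  · exact key u v h hu
  · have hv := hH.isAcyclic.mem_support_of_ne_mem_support_of_adj_of_isPath (hp u) (hp v) h hu
    simp only
    rw [key v u h.symm hv, hf u v h, inv_mul_cancel_right]

section Graph

variable {R : ℕ} {m : Fin R → ℕ}

/-- The pairs `(i, k)` that index the standard generators; they also index a decomposition of the
vertex groups `V_m` into copies of `ℤ × ℤ`. -/
abbrev Node (m : Fin R → ℕ) : Type := (i : Fin R) × Fin (m i)

/-- The edges of the graph of groups with vertex groups `ℤ × ℤ`: the edges of `Γ`, and the edges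
that join the consecutive nodes `(i, k)` and `(i, k + 1)`. -/
inductive NodeEdge (m : Fin R → ℕ) : Type
  | strip (e : Node m) : NodeEdge m
  | link (i : Fin R) (k : ℕ) (hk : k + 1 < m i) : NodeEdge m

/-- The direction of the standard generator at a node. At the last node of a vertex the standard
generator is the diagonal element, and only the diagonal direction is used there. -/
def aDir (e : Node m) : Dir := if (e.2 : ℕ) + 1 < m e.1 then .a else .d

theorem aDir_of_lt {i : Fin R} {k : Fin (m i)} (h : (k : ℕ) + 1 < m i) :
    aDir (⟨i, k⟩ : Node m) = .a := if_pos h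

theorem aDir_of_not_lt {i : Fin R} {k : Fin (m i)} (h : ¬ (k : ℕ) + 1 < m i) :
    aDir (⟨i, k⟩ : Node m) = .d := if_neg h

theorem bGen_of_lt {i : Fin R} {k : Fin (m i)} (h : (k : ℕ) < m i - 1) :
    bGen i k = FreeGroup.of (Letter.b i ⟨k, h⟩) := dif_pos h

theorem bGen_of_not_lt {i : Fin R} {k : Fin (m i)} (h : ¬ (k : ℕ) + 1 < m i) :
    bGen i k = aGen i k := dif_neg (by omega)

variable (hm : ∀ i, 0 < m i) {p q : ℕ} (hp : 0 < p) (hq : 0 < q)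
  (σ : (i : Fin R) → Fin (m i) → Fin R) (T : Set (Node m))

/-- The graph of groups with vertex group `⟨a_k⟩ × ⟨b_k⟩` at the node `(i, k - 1)`. The diagonal
element `b_{k-1} = a_k b_k` of a node is identified along a `link` with an element of the preceding
node, and the edges of `Γ` start at the standard generators and end at the diagonal elements of
the first nodes. At the last node of a vertex, the cyclic group generated by the standard generator
is enlarged to `ℤ × ℤ`, in which it is the diagonal. -/
def planeGraph : PlaneGraph (Node m) (NodeEdge m × Bool) where
  src
    | (.strip e, true) => e
    | (.strip e, false) => ⟨σ e.1 e.2, ⟨0, hm _⟩⟩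
    | (.link i k hk, true) => ⟨i, ⟨k, Nat.lt_of_succ_lt hk⟩⟩
    | (.link i k hk, false) => ⟨i, ⟨k + 1, hk⟩⟩
  inv s := (s.1, !s.2)
  dir
    | (.strip e, true) => aDir e
    | (.strip _, false) => .d
    | (.link _ _ _, true) => .b
    | (.link _ _ _, false) => .d
  pow
    | (.strip _, true) => p
    | (.strip _, false) => q
    | (.link _ _ _, _) => 1
  inv_inv s := by simp
  pow_pos s := by
    rcases s with ⟨_ | _, _ | _⟩ <;> first | assumption | exact Nat.one_pos

/-- The words for the directions at the nodes. At a last node the direction `b` is represented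
by `1`, and both other directions by the standard generator. -/
def nodeGen : Node m → Dir → FreeGroup (Letter m)
  | ⟨i, k⟩, .a => aGen i k
  | ⟨i, k⟩, .b => if h : (k : ℕ) + 1 < m i then bGen i ⟨k + 1, h⟩ else 1
  | ⟨i, k⟩, .d => bGen i k

theorem nodeGen_aDir (e : Node m) : nodeGen e (aDir e) = aGen e.1 e.2 := by
  obtain ⟨i, k⟩ := e
  by_cases h : (k : ℕ) + 1 < m i
  · rw [aDir_of_lt h]
    rfl
  · rw [aDir_of_not_lt h]
    exact bGen_of_not_lt h

theorem near_strip (e : Node m) : Near (relators p q σ T)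
    ((sGen e.1 e.2)⁻¹ * aGen e.1 e.2 ^ p * sGen e.1 e.2) (bGen (σ e.1 e.2) ⟨0, hm _⟩ ^ q) 1 := by
  refine Near.of_mem ?_
  have := IsRelator.strip (p := p) (q := q) (σ := σ) (T := T) e.1 e.2
  rwa [cGen, dif_pos (hm _)] at this

/-- The realization of the graph of groups in `G_{r,P}`. -/
def planeRealization : (planeGraph hm hp hq σ).Realization (relators p q σ T) where
  gen := nodeGen
  stable
    | (.strip e, true) => sGen e.1 e.2
    | (.strip e, false) => (sGen e.1 e.2)⁻¹
    | (.link _ _ _, _) => 1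
  near_ab := by
    rintro ⟨i, k⟩
    simp only [nodeGen]
    split_ifs with h
    · exact Near.of_mem (IsRelator.left i k h)
    · rw [mul_one, bGen_of_not_lt h]
      exact Near.refl _ zero_le_one
  near_ba := by
    rintro ⟨i, k⟩
    simp only [nodeGen]
    split_ifs with h
    · exact Near.of_mem (IsRelator.right i k h)
    · rw [one_mul, bGen_of_not_lt h]
      exact Near.refl _ zero_le_one
  stable_inv := by
    rintro ⟨_ | _, _ | _⟩ <;> simp [planeGraph]
  near_edge := by
    rintro ⟨e | ⟨i, k, hk⟩, _ | _⟩
    · have := near_strip (p := p) (q := q) hm σ T e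
      rw [← nodeGen_aDir] at this
      simpa [planeGraph, PlaneGraph.tgt, nodeGen] using this
    · have := (((near_strip (p := p) (q := q) hm σ T e).symm.mul_left
        (sGen e.1 e.2)).mul_right (sGen e.1 e.2)⁻¹)
      rw [← nodeGen_aDir] at this
      simpa [planeGraph, PlaneGraph.tgt, nodeGen, mul_assoc] using this
    · simpa [planeGraph, PlaneGraph.tgt, nodeGen, hk] using Near.refl _ zero_le_one
    · simpa [planeGraph, PlaneGraph.tgt, nodeGen, hk] using Near.refl _ zero_le_one

end Graph

/-! ### The action of `G_{r,P}` on the normal forms, and words as paths -/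

section Potential

variable {R : ℕ} {m : Fin R → ℕ} {hm : ∀ i, 0 < m i} {p q : ℕ} {hp : 0 < p} {hq : 0 < q}
  {σ : (i : Fin R) → Fin (m i) → Fin R} {T : Set (Node m)}
  {γ : Node m → Equiv.Perm (planeGraph hm hp hq σ).NormalForm}

/-- The action of the fundamental groupoid, transported to a vertex by `γ`, is trivial for the
links and for the edges of `T`. -/
structure IsPotential (T : Set (Node m))
    (γ : Node m → Equiv.Perm (planeGraph hm hp hq σ).NormalForm) : Prop where
  strip : ∀ e ∈ T, γ ⟨σ e.1 e.2, ⟨0, hm _⟩⟩ =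
    γ e * (planeGraph hm hp hq σ).stablePerm (.strip e, true)
  link : ∀ i k hk, γ ⟨i, ⟨k + 1, hk⟩⟩ =
    γ ⟨i, ⟨k, Nat.lt_of_succ_lt hk⟩⟩ * (planeGraph hm hp hq σ).stablePerm (.link i k hk, true)

variable (hm hp hq σ) in
/-- The product of the links from the first node of a vertex to the `k`-th one. -/
noncomputable def linkPerm (i : Fin R) :
    ℕ → Equiv.Perm (planeGraph hm hp hq σ).NormalForm
  | 0 => 1
  | k + 1 => linkPerm i k *
      if h : k + 1 < m i then (planeGraph hm hp hq σ).stablePerm (.link i k h, true) else 1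

variable (hm hp hq) in
theorem exists_isPotential (hT : IsMaximalTree σ T) :
    ∃ γ : Node m → Equiv.Perm (planeGraph hm hp hq σ).NormalForm, IsPotential T γ := by
  classical
  obtain ⟨hloop, hinj, htree⟩ := hT
  let N : Node m → Equiv.Perm ((planeGraph hm hp hq σ).NormalForm) := fun e =>
    linkPerm hm hp hq σ e.1 e.2 * (planeGraph hm hp hq σ).stablePerm (.strip e, true)
  -- `edgeOf z` is the edge of `T` with the unordered pair of endpoints `z`.
  have hex : ∀ z : Sym2 (Fin R), ∃ e : Option (Node m),
      z ∈ (fun e : Node m => s(e.1, σ e.1 e.2)) '' T →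
        ∃ e' ∈ T, e = some e' ∧ s(e'.1, σ e'.1 e'.2) = z := by
    intro z
    by_cases hz : z ∈ (fun e : Node m => s(e.1, σ e.1 e.2)) '' T
    · obtain ⟨e, he, rfl⟩ := hz
      exact ⟨some e, fun _ => ⟨e, he, rfl, rfl⟩⟩
    · exact ⟨none, fun h => absurd h hz⟩
  choose edgeOf hedge using hex
  let f : Fin R → Fin R → Equiv.Perm ((planeGraph hm hp hq σ).NormalForm) := fun u v =>
    (edgeOf s(u, v)).elim 1 fun e => if e.1 = u then N e else (N e)⁻¹
  have hf : ∀ e ∈ T, f e.1 (σ e.1 e.2) = N e := by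
    intro e he
    obtain ⟨e', he', h1, h2⟩ := hedge s(e.1, σ e.1 e.2) ⟨e, he, rfl⟩
    obtain rfl := hinj he' he h2
    simp [f, h1]
  obtain ⟨Γ, hΓ⟩ := exists_potential_of_isTree htree f (by
    intro u v h
    rw [SimpleGraph.fromEdgeSet_adj] at h
    obtain ⟨e, -, h1, h2⟩ := hedge _ h.1
    have h1' : edgeOf s(v, u) = some e := by rw [Sym2.eq_swap, h1]
    simp only [f, h1, h1', Option.elim_some]
    rcases Sym2.eq_iff.mp h2 with ⟨rfl, -⟩ | ⟨rfl, -⟩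
    · rw [if_neg h.2, if_pos rfl]
    · rw [if_pos rfl, if_neg h.2.symm, inv_inv])
  refine ⟨fun e => Γ e.1 * linkPerm hm hp hq σ e.1 e.2, ?_, ?_⟩
  · intro e he
    have h := hΓ e.1 (σ e.1 e.2) (by
      rw [SimpleGraph.fromEdgeSet_adj]
      exact ⟨⟨e, he, rfl⟩, (hloop e he).symm⟩)
    rw [hf e he] at h
    simp only [linkPerm, mul_one, h, N, mul_assoc]
  · intro i k hk
    simp only [linkPerm, dif_pos hk, mul_assoc]

variable (γ) in
/-- There is a path from `u` to `v` that represents `1` in `G_{r,P}` and that is trivial for the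
transported action. -/
def Linked (T : Set (Node m)) (u v : Node m) : Prop :=
  ∃ (l : List (PlaneGraph.Step (Node m) (NodeEdge m × Bool))) (k : ℝ),
    (planeGraph hm hp hq σ).IsPath u l v ∧ (planeGraph hm hp hq σ).pathPerm l = (γ u)⁻¹ * γ v ∧
    Near (relators p q σ T) ((planeRealization hm hp hq σ T).eval l) 1 k

theorem Linked.refl (u : Node m) : Linked γ T u u :=
  ⟨[], 0, rfl, by simp [PlaneGraph.pathPerm], by
    simpa [PlaneGraph.Realization.eval] using Near.refl 1 le_rfl⟩

theorem Linked.symm {u v : Node m} (h : Linked γ T u v) : Linked γ T v u := by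
  obtain ⟨l, k, h1, h2, h3⟩ := h
  refine ⟨_, k, h1.reverse, ?_, ?_⟩
  · rw [PlaneGraph.pathPerm_reverse, h2, mul_inv_rev, inv_inv]
  · rw [PlaneGraph.Realization.eval_reverse]
    simpa using h3.inv

theorem Linked.trans {u v w : Node m} (h : Linked γ T u v) (h' : Linked γ T v w) :
    Linked γ T u w := by
  obtain ⟨l, k, h1, h2, h3⟩ := h
  obtain ⟨l', k', h1', h2', h3'⟩ := h'
  refine ⟨_, k + k', h1.append h1', ?_, ?_⟩
  · rw [PlaneGraph.pathPerm_append, h2, h2', mul_assoc, mul_inv_cancel_left]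
  · rw [PlaneGraph.Realization.eval_append]
    simpa using h3.mul h3'

theorem IsPotential.linked (hT : IsMaximalTree σ T) (hγ : IsPotential T γ) (u v : Node m) :
    Linked γ T u v := by
  have hnode : ∀ (i : Fin R) (k : ℕ) (hk : k < m i),
      Linked γ T ⟨i, ⟨0, hm i⟩⟩ ⟨i, ⟨k, hk⟩⟩ := by
    intro i k
    induction k with
    | zero => exact fun _ => Linked.refl _
    | succ k ih =>
      intro hk
      refine (ih (Nat.lt_of_succ_lt hk)).trans ⟨[.edge (.link i k hk, true)], 0, ⟨rfl, rfl⟩, ?_, ?_⟩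
      · rw [hγ.link, inv_mul_cancel_left]
        simp [PlaneGraph.pathPerm, PlaneGraph.stepPerm]
      · simpa [PlaneGraph.Realization.eval, PlaneGraph.Realization.evalStep,
          planeRealization] using Near.refl 1 le_rfl
  have hstrip : ∀ e ∈ T, Linked γ T ⟨e.1, ⟨0, hm _⟩⟩ ⟨σ e.1 e.2, ⟨0, hm _⟩⟩ := by
    intro e he
    refine (hnode e.1 e.2 e.2.2).trans ⟨[.edge (.strip e, true)], 1, ⟨rfl, rfl⟩, ?_, ?_⟩
    · rw [hγ.strip e he, inv_mul_cancel_left]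
      simp [PlaneGraph.pathPerm, PlaneGraph.stepPerm]
    · have : sGen e.1 e.2 ∈ relators p q σ T := IsRelator.tree e.1 e.2 he
      refine Near.of_mem ?_
      simpa [PlaneGraph.Realization.eval, PlaneGraph.Realization.evalStep,
          planeRealization] using this
  have hbase : ∀ i j : Fin R, Linked γ T ⟨i, ⟨0, hm i⟩⟩ ⟨j, ⟨0, hm j⟩⟩ := by
    intro i j
    obtain ⟨w⟩ := hT.2.2.connected i j
    induction w with
    | nil => exact Linked.refl _
    | cons h _ ih =>
      refine Linked.trans ?_ ih
      rw [SimpleGraph.fromEdgeSet_adj] at h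
      obtain ⟨⟨e, he, h⟩, -⟩ := h
      rcases Sym2.eq_iff.mp h with ⟨rfl, rfl⟩ | ⟨rfl, rfl⟩
      · exact hstrip e he
      · exact (hstrip e he).symm
  exact ((hnode u.1 u.2 u.2.2).symm.trans (hbase u.1 v.1)).trans (hnode v.1 v.2 v.2.2)

variable (m) in
/-- The step of a letter. -/
def letterStep : Letter m → PlaneGraph.Step (Node m) (NodeEdge m × Bool)
  | .a i k => .gen ⟨i, k⟩ (aDir ⟨i, k⟩) true
  | .b i k => .gen ⟨i, ⟨k, k.2.trans_le (Nat.sub_le _ _)⟩⟩ .d true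
  | .s i k => .edge (.strip ⟨i, k⟩, true)

theorem evalStep_letterStep (x : Letter m) :
    (planeRealization hm hp hq σ T).evalStep (letterStep m x) = FreeGroup.of x := by
  cases x with
  | a i k => exact (zpow_one _).trans (nodeGen_aDir ⟨i, k⟩)
  | b i k => exact (zpow_one _).trans (bGen_of_lt (m := m) k.2)
  | s i k => rfl

variable (γ) in
/-- The action of a letter, transported by `γ`. -/
noncomputable def letterPerm (x : Letter m) : Equiv.Perm ((planeGraph hm hp hq σ).NormalForm) :=
  γ ((planeGraph hm hp hq σ).stepSrc (letterStep m x)) *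
    (planeGraph hm hp hq σ).stepPerm (letterStep m x) *
    (γ ((planeGraph hm hp hq σ).stepTgt (letterStep m x)))⁻¹

variable (γ) in
/-- The element `g` of the vertex group at `e`, transported by `γ`. -/
noncomputable def nodePerm (e : Node m) : Multiplicative (ℤ × ℤ) →*
    Equiv.Perm ((planeGraph hm hp hq σ).NormalForm) :=
  (MulAut.conj (γ e)).toMonoidHom.comp ((planeGraph hm hp hq σ).translation)

theorem nodePerm_apply (e : Node m) (g : Multiplicative (ℤ × ℤ)) :
    nodePerm γ e g = γ e * (planeGraph hm hp hq σ).translation g * (γ e)⁻¹ := rfl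

theorem nodePerm_injective (e : Node m) : Function.Injective (nodePerm γ e) :=
  (MulAut.conj (γ e)).injective.comp ((planeGraph hm hp hq σ).translation_injective)

theorem nodePerm_zpow (e : Node m) (x : ℤ × ℤ) (n : ℤ) :
    nodePerm γ e (.ofAdd x) ^ n = nodePerm γ e (.ofAdd (n • x)) := by
  rw [← map_zpow (nodePerm γ e), ← ofAdd_zsmul]

theorem lift_aGen (e : Node m) :
    FreeGroup.lift (letterPerm γ) (aGen e.1 e.2) = nodePerm γ e (.ofAdd (aDir e).vec) := by
  simp [aGen, letterPerm, letterStep, PlaneGraph.stepSrc, PlaneGraph.stepTgt,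
    PlaneGraph.stepPerm, nodePerm_apply]

theorem lift_bGen (i : Fin R) (k : Fin (m i)) :
    FreeGroup.lift (letterPerm γ) (bGen i k) = nodePerm γ ⟨i, k⟩ (.ofAdd Dir.d.vec) := by
  by_cases h : (k : ℕ) + 1 < m i
  · rw [bGen_of_lt (Nat.lt_sub_of_add_lt h)]
    simp [letterPerm, letterStep, PlaneGraph.stepSrc, PlaneGraph.stepTgt,
      PlaneGraph.stepPerm, nodePerm_apply]
  · rw [bGen_of_not_lt h, lift_aGen ⟨i, k⟩, aDir_of_not_lt h]

theorem IsPotential.lift_bGen_succ (hγ : IsPotential T γ) (i : Fin R) (k : ℕ)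
    (hk : k + 1 < m i) :
    FreeGroup.lift (letterPerm γ) (bGen i ⟨k + 1, hk⟩) =
      nodePerm γ ⟨i, ⟨k, Nat.lt_of_succ_lt hk⟩⟩ (.ofAdd Dir.b.vec) := by
  have h : (planeGraph hm hp hq σ).stablePerm (.link i k hk, true) *
      (planeGraph hm hp hq σ).translation (.ofAdd Dir.d.vec) =
      (planeGraph hm hp hq σ).translation (.ofAdd Dir.b.vec) *
        (planeGraph hm hp hq σ).stablePerm (.link i k hk, true) := by
    simpa [PlaneGraph.unit, planeGraph] using
      (planeGraph hm hp hq σ).stablePerm_mul_translation (.link i k hk, true) 1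
  rw [lift_bGen, nodePerm_apply, nodePerm_apply, hγ.link, mul_inv_rev,
    mul_assoc (γ _) ((planeGraph hm hp hq σ).stablePerm _), h]
  simp only [mul_assoc, mul_inv_cancel_left]

/-- The transported action is an action of `G_{r,P}`. -/
theorem IsPotential.lift_relator (hγ : IsPotential T γ) {u : FreeGroup (Letter m)}
    (hu : u ∈ relators p q σ T) : FreeGroup.lift (letterPerm γ) u = 1 := by
  obtain ⟨i, k, hk⟩ | ⟨i, k, hk⟩ | ⟨i, k⟩ | ⟨i, k, h⟩ := hu
  · rw [map_mul, map_mul, map_inv, mul_inv_eq_one, hγ.lift_bGen_succ, lift_bGen,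
      lift_aGen ⟨i, ⟨k, _⟩⟩, aDir_of_lt hk, ← map_mul]
    rfl
  · rw [map_mul, map_mul, map_inv, mul_inv_eq_one, hγ.lift_bGen_succ, lift_bGen,
      lift_aGen ⟨i, ⟨k, _⟩⟩, aDir_of_lt hk, ← map_mul]
    rfl
  · have h : (planeGraph hm hp hq σ).stablePerm (.strip ⟨i, k⟩, true) *
        (planeGraph hm hp hq σ).translation (.ofAdd ((q : ℤ) • Dir.d.vec)) =
        (planeGraph hm hp hq σ).translation (.ofAdd ((p : ℤ) • (aDir ⟨i, k⟩).vec)) *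
          (planeGraph hm hp hq σ).stablePerm (.strip ⟨i, k⟩, true) := by
      simpa only [PlaneGraph.unit, planeGraph, one_smul, Bool.not_true] using
        (planeGraph hm hp hq σ).stablePerm_mul_translation (.strip ⟨i, k⟩, true) 1
    have hs : FreeGroup.lift (letterPerm γ) (sGen i k) = γ ⟨i, k⟩ *
        (planeGraph hm hp hq σ).stablePerm (.strip ⟨i, k⟩, true) *
          (γ ⟨σ i k, ⟨0, hm _⟩⟩)⁻¹ := by
      simp only [sGen, FreeGroup.lift_apply_of]
      rfl
    rw [cGen, dif_pos (hm _), map_mul, map_inv, mul_inv_eq_one, map_mul, map_mul, map_inv,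
      map_pow, map_pow, lift_bGen, lift_aGen ⟨i, k⟩, ← zpow_natCast, ← zpow_natCast,
      nodePerm_zpow, nodePerm_zpow, hs, mul_assoc, inv_mul_eq_iff_eq_mul, nodePerm_apply,
      nodePerm_apply]
    simp only [mul_assoc, inv_mul_cancel_left]
    rw [← mul_assoc _ _ (γ ⟨σ i k, ⟨0, hm _⟩⟩)⁻¹, ← h, mul_assoc]
  · have hs : FreeGroup.lift (letterPerm γ) (sGen i k) = γ ⟨i, k⟩ *
        (planeGraph hm hp hq σ).stablePerm (.strip ⟨i, k⟩, true) *
          (γ ⟨σ i k, ⟨0, hm _⟩⟩)⁻¹ := by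
      simp only [sGen, FreeGroup.lift_apply_of]
      rfl
    rw [hs, hγ.strip _ h, mul_inv_cancel]

theorem IsPotential.lift_eq (hγ : IsPotential T γ) {u v : FreeGroup (Letter m)}
    (h : PresentedGroup.mk (relators p q σ T) u = PresentedGroup.mk (relators p q σ T) v) :
    FreeGroup.lift (letterPerm γ) u = FreeGroup.lift (letterPerm γ) v :=
  congrArg (PresentedGroup.toGroup fun _ => hγ.lift_relator) h

/-- Every word can be turned into a path between given nodes by inserting paths that represent
`1`. -/
theorem exists_path_of_word {L : ℝ} (hL : ∀ u v : Node m,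
      ∃ l : List (PlaneGraph.Step (Node m) (NodeEdge m × Bool)),
        (planeGraph hm hp hq σ).IsPath u l v ∧
        (planeGraph hm hp hq σ).pathPerm l = (γ u)⁻¹ * γ v ∧ (l.length : ℝ) ≤ L ∧
        Near (relators p q σ T) ((planeRealization hm hp hq σ T).eval l) 1 L)
    (w : List (Letter m × Bool)) (u v : Node m) :
    ∃ l : List (PlaneGraph.Step (Node m) (NodeEdge m × Bool)),
      (planeGraph hm hp hq σ).IsPath u l v ∧
      (planeGraph hm hp hq σ).pathPerm l =
        (γ u)⁻¹ * FreeGroup.lift (letterPerm γ) (FreeGroup.mk w) * γ v ∧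
      (l.length : ℝ) ≤ L + (L + 1) * w.length ∧
      Near (relators p q σ T) ((planeRealization hm hp hq σ T).eval l) (FreeGroup.mk w)
        (L + L * w.length) := by
  induction w generalizing u with
  | nil =>
    obtain ⟨l, h1, h2, h3, h4⟩ := hL u v
    exact ⟨l, h1, by simpa [← FreeGroup.one_eq_mk] using h2, by simpa using h3,
      by simpa [← FreeGroup.one_eq_mk] using h4⟩
  | cons a w ih =>
    obtain ⟨x, ε⟩ := a
    -- The path of the single letter `x ^ ε`, from `u'` to `v'`.
    obtain ⟨u', v', s, hs1, hs2, hs3⟩ : ∃ u' v' s,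
        (planeGraph hm hp hq σ).IsPath u' [s] v' ∧
        (planeGraph hm hp hq σ).stepPerm s =
          (γ u')⁻¹ * FreeGroup.lift (letterPerm γ) (FreeGroup.mk [(x, ε)]) * γ v' ∧
        (planeRealization hm hp hq σ T).evalStep s = FreeGroup.mk [(x, ε)] := by
      have hx : FreeGroup.lift (letterPerm γ) (FreeGroup.of x) = letterPerm γ x :=
        FreeGroup.lift_apply_of
      have hpath : (planeGraph hm hp hq σ).IsPath
        ((planeGraph hm hp hq σ).stepSrc (letterStep m x)) [letterStep m x]
        ((planeGraph hm hp hq σ).stepTgt (letterStep m x)) := ⟨rfl, rfl⟩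
      cases ε with
      | true =>
        refine ⟨_, _, letterStep m x, hpath, ?_, evalStep_letterStep x⟩
        change _ = _ * FreeGroup.lift (letterPerm γ) (FreeGroup.of x) * _
        rw [hx, letterPerm]
        group
      | false =>
        have hinv : FreeGroup.mk [(x, false)] = (FreeGroup.of x)⁻¹ := rfl
        refine ⟨_, _, (planeGraph hm hp hq σ).stepInv (letterStep m x), hpath.reverse, ?_, ?_⟩
        · rw [hinv, map_inv, hx, letterPerm, PlaneGraph.stepPerm_stepInv]
          group
        · rw [hinv, PlaneGraph.Realization.evalStep_stepInv, evalStep_letterStep]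
    obtain ⟨l, h1, h2, h3, h4⟩ := hL u u'
    obtain ⟨l', h1', h2', h3', h4'⟩ := ih v'
    have hmk : FreeGroup.mk ((x, ε) :: w) = FreeGroup.mk [(x, ε)] * FreeGroup.mk w := by
      rw [FreeGroup.mul_mk]
      rfl
    refine ⟨l ++ ([s] ++ l'), h1.append (hs1.append h1'), ?_, ?_, ?_⟩
    · rw [PlaneGraph.pathPerm_append, PlaneGraph.pathPerm_append, h2, h2', hmk, map_mul]
      have : (planeGraph hm hp hq σ).pathPerm [s] = (planeGraph hm hp hq σ).stepPerm s := by
        simp [PlaneGraph.pathPerm]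
      rw [this, hs2]
      group
    · simp only [List.length_append, List.length_cons, List.length_nil]
      push_cast
      linarith
    · have hs : (planeRealization hm hp hq σ T).eval [s] = FreeGroup.mk [(x, ε)] := by
        simpa [PlaneGraph.Realization.eval] using hs3
      rw [PlaneGraph.Realization.eval_append, PlaneGraph.Realization.eval_append, hs, hmk]
      have := h4.mul (h4'.mul_left (FreeGroup.mk [(x, ε)]))
      rw [one_mul] at this
      refine this.mono ?_
      push_cast [List.length_cons]
      linarith

end Potential

/-! ### Weights from the Perron–Frobenius eigenvector, and the bounds for words -/

section TailSum

variable {n : ℕ} (c : Fin n → ℝ)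

/-- The sum of the `c l` with `k ≤ l`. -/
noncomputable def tailSum (k : ℕ) : ℝ := ∑ l with k ≤ l.val, c l

theorem tailSum_zero : tailSum c 0 = ∑ l, c l := by simp [tailSum]

theorem tailSum_eq_add (k : Fin n) : tailSum c k = c k + tailSum c (k + 1) := by
  have h : (Finset.univ.filter fun l : Fin n => (k : ℕ) ≤ l.val) =
      insert k (Finset.univ.filter fun l : Fin n => (k : ℕ) + 1 ≤ l.val) := by
    ext l
    simp only [Finset.mem_filter, Finset.mem_univ, true_and, Finset.mem_insert, Fin.ext_iff]
    omega
  rw [tailSum, h, Finset.sum_insert (by simp)]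
  rfl

theorem tailSum_of_le {k : ℕ} (h : n ≤ k) : tailSum c k = 0 := by
  rw [tailSum, Finset.filter_false_of_mem, Finset.sum_empty]
  intro l _
  omega

variable {c}

theorem tailSum_nonneg (hc : ∀ l, 0 < c l) (k : ℕ) : 0 ≤ tailSum c k :=
  Finset.sum_nonneg fun l _ => (hc l).le

theorem tailSum_pos (hc : ∀ l, 0 < c l) (k : Fin n) : 0 < tailSum c k := by
  rw [tailSum_eq_add]
  exact add_pos_of_pos_of_nonneg (hc k) (tailSum_nonneg hc _)

theorem tailSum_le_sum (hc : ∀ l, 0 < c l) (k : ℕ) : tailSum c k ≤ ∑ l, c l :=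
  Finset.sum_le_sum_of_subset_of_nonneg (Finset.filter_subset _ _) fun l _ _ => (hc l).le

end TailSum

section Weights

variable {R : ℕ} {m : Fin R → ℕ} {hm : ∀ i, 0 < m i} {p q : ℕ} {hp : 0 < p} {hq : 0 < q}
  {σ : (i : Fin R) → Fin (m i) → Fin R}

/-- The weights obtained from weights `c` of the standard generators: a diagonal element, as the
product of standard generators, has the sum of their weights. -/
noncomputable def nodeWeight (c : (i : Fin R) → Fin (m i) → ℝ) : Node m → Dir → ℝ
  | ⟨i, k⟩, .a => c i k
  | ⟨i, k⟩, .b => if (k : ℕ) + 1 < m i then tailSum (c i) (k + 1) else c i k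
  | ⟨i, k⟩, .d => tailSum (c i) k

theorem nodeWeight_aDir (c : (i : Fin R) → Fin (m i) → ℝ) (e : Node m) :
    nodeWeight c e (aDir e) = c e.1 e.2 := by
  obtain ⟨i, k⟩ := e
  by_cases h : (k : ℕ) + 1 < m i
  · rw [aDir_of_lt h]
    rfl
  · rw [aDir_of_not_lt h]
    simp only [nodeWeight]
    rw [tailSum_eq_add, tailSum_of_le _ (not_lt.mp h), add_zero]

variable (hm hp hq) in
/-- `nodeWeight c` is a weighting if `c` is an eigenvector, in the sense of `hedge`. -/
noncomputable def nodeWeighting {θ : ℝ} (c : (i : Fin R) → Fin (m i) → ℝ) (hc : ∀ i k, 0 < c i k)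
    (hsum : ∀ i, ∑ k, c i k ≤ 1)
    (hedge : ∀ i k, c i k * (p : ℝ) ^ (1 / θ) = (∑ l, c (σ i k) l) * (q : ℝ) ^ (1 / θ)) :
    (planeGraph hm hp hq σ).Weighting θ where
  weight := nodeWeight c
  pos := by
    rintro ⟨i, k⟩ (_ | _ | _) <;> simp only [nodeWeight]
    · exact hc i k
    · split_ifs with h
      · exact tailSum_pos (hc i) ⟨k + 1, h⟩
      · exact hc i k
    · exact tailSum_pos (hc i) k
  le_one := by
    have h1 : ∀ i k, c i k ≤ 1 := fun i k =>
      (Finset.single_le_sum (fun l _ => (hc i l).le) (Finset.mem_univ k)).trans (hsum i)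
    rintro ⟨i, k⟩ (_ | _ | _) <;> simp only [nodeWeight]
    · exact h1 i k
    · split_ifs with h
      · exact (tailSum_le_sum (hc i) _).trans (hsum i)
      · exact h1 i k
    · exact (tailSum_le_sum (hc i) _).trans (hsum i)
  a_le_d := by
    rintro ⟨i, k⟩
    simp only [nodeWeight]
    rw [tailSum_eq_add]
    linarith [tailSum_nonneg (hc i) (k + 1)]
  b_le_d := by
    rintro ⟨i, k⟩
    simp only [nodeWeight]
    rw [tailSum_eq_add]
    split_ifs
    · linarith [hc i k]
    · linarith [tailSum_nonneg (hc i) (k + 1)]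
  d_le := by
    rintro ⟨i, k⟩
    simp only [nodeWeight]
    rw [tailSum_eq_add]
    split_ifs with h
    · exact le_rfl
    · rw [tailSum_of_le _ (not_lt.mp h)]
      linarith [hc i k]
  edge := by
    rintro ⟨e | ⟨i, k, hk⟩, _ | _⟩ <;>
      simp only [planeGraph, PlaneGraph.tgt, Bool.not_true, Bool.not_false]
    · rw [nodeWeight_aDir, hedge, ← tailSum_zero]
      rfl
    · rw [nodeWeight_aDir, hedge, ← tailSum_zero]
      rfl
    · simp only [nodeWeight, if_pos hk]
    · simp only [nodeWeight, if_pos hk]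

end Weights

/-- Paths that represent a power of a direction have area bounded by the power `2 θ` of the
length, and this passes to the words in the generators of `G_{r,P}`. -/
theorem exists_near_of_weighting {R : ℕ} {m : Fin R → ℕ} {hm : ∀ i, 0 < m i} {p q : ℕ}
    {hp : 0 < p} {hq : 0 < q} {σ : (i : Fin R) → Fin (m i) → Fin R} {T : Set (Node m)}
    (hT : IsMaximalTree σ T) {θ : ℝ} (hθ : 1 ≤ θ)
    (ω : (planeGraph hm hp hq σ).Weighting θ) :
    ∃ E : ℝ, ∀ (w : List (Letter m × Bool)) (x : FreeGroup (Letter m)) (N : ℤ),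
      ((∃ i k, x = aGen i k) ∨ (∃ i, x = cGen i)) →
      (PresentedGroup.mk (relators p q σ T) (FreeGroup.mk w) : G p q σ T) =
        PresentedGroup.mk (relators p q σ T) x ^ N →
      Near (relators p q σ T) (FreeGroup.mk w) (x ^ N) (E * (w.length : ℝ) ^ (2 * θ)) := by
  obtain ⟨γ, hγ⟩ := exists_isPotential hm hp hq hT
  obtain ⟨κ, hκ⟩ := Finite.exists_le fun v : Node m =>
    max ((ω.weight v .a)⁻¹ ^ θ) (max ((ω.weight v .b)⁻¹ ^ θ) ((ω.weight v .d)⁻¹ ^ θ))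
  have hκ' : ∀ v x, (ω.weight v x)⁻¹ ^ θ ≤ κ := by
    intro v x
    have := hκ v
    simp only [max_le_iff] at this
    cases x
    exacts [this.1, this.2.1, this.2.2]
  -- A common bound `L` for the lengths and the areas of the paths between the nodes.
  choose l k hl1 hl2 hl3 using fun uv : Node m × Node m => hγ.linked hT uv.1 uv.2
  obtain ⟨L, hL⟩ := Finite.exists_le fun uv => max ((l uv).length : ℝ) (k uv)
  have hL' : ∀ u v : Node m, ∃ l : List (PlaneGraph.Step (Node m) (NodeEdge m × Bool)),
        (planeGraph hm hp hq σ).IsPath u l v ∧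
        (planeGraph hm hp hq σ).pathPerm l = (γ u)⁻¹ * γ v ∧ (l.length : ℝ) ≤ L ∧
        Near (relators p q σ T) ((planeRealization hm hp hq σ T).eval l) 1 L := fun u v =>
    ⟨l (u, v), hl1 (u, v), hl2 (u, v), (le_max_left _ _).trans (hL (u, v)),
      (hl3 (u, v)).mono ((le_max_right _ _).trans (hL (u, v)))⟩
  have hθ0 : 0 < θ := by linarith
  -- The first summand pays for the inserted paths, the second one for collecting the path, which is
  -- at most `2 * L + 1` times as long as the word.
  refine ⟨2 * L + 5 * κ ^ 2 * ((2 * L + 1) ^ θ) ^ 2, ?_⟩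
  intro w x N hx hw
  -- The element `x` is a direction at a node.
  obtain ⟨v, y, hgen, hlift⟩ : ∃ (v : Node m) (y : Dir), nodeGen v y = x ∧
      FreeGroup.lift (letterPerm γ) x = nodePerm γ v (.ofAdd y.vec) := by
    rcases hx with ⟨i, k, rfl⟩ | ⟨i, rfl⟩
    · exact ⟨⟨i, k⟩, _, nodeGen_aDir ⟨i, k⟩, lift_aGen ⟨i, k⟩⟩
    · rw [cGen, dif_pos (hm i)]
      exact ⟨⟨i, ⟨0, hm i⟩⟩, .d, rfl, lift_bGen i _⟩
  have hlw : FreeGroup.lift (letterPerm γ) (FreeGroup.mk w) =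
      nodePerm γ v (.ofAdd (N • y.vec)) := by
    rw [hγ.lift_eq (v := x ^ N) (by rw [hw, map_zpow]), map_zpow, hlift, nodePerm_zpow]
  rcases eq_or_ne w [] with rfl | hne
  · rw [← FreeGroup.one_eq_mk, map_one] at hlw
    have h0 : N • y.vec = (0 : ℤ) • y.vec := by
      rw [zero_smul]
      exact congrArg Multiplicative.toAdd
        (nodePerm_injective (γ := γ) v (hlw.symm.trans (map_one _).symm))
    obtain rfl : N = 0 := y.zsmul_vec_injective h0
    refine Near.mono (Near.refl _ le_rfl) ?_
    rw [List.length_nil, Nat.cast_zero, Real.zero_rpow (by positivity), mul_zero]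
  · obtain ⟨l', h1, h2, h3, h4⟩ := exists_path_of_word hL' w v v
    have hP := (PlaneGraph.isStable_collectible (ρ := planeRealization hm hp hq σ T) (ω := ω)
      hθ hκ' le_rfl).of_pathPerm_eq h1 (g := N • y.vec) (by
        rw [h2, hlw, nodePerm_apply]
        group)
    have hn := hP.near_zpow hθ hκ' le_rfl
    have hgen' : (planeRealization hm hp hq σ T).gen v y = x := hgen
    rw [hgen'] at hn
    refine (h4.symm.trans hn).mono ?_
    have hlen : (1 : ℝ) ≤ w.length := by
      exact_mod_cast List.length_pos_of_ne_nil hne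
    have hL0 : 0 ≤ L := (hl3 (v, v)).nonneg.trans ((le_max_right _ _).trans (hL (v, v)))
    have e1 : (w.length : ℝ) ≤ (w.length : ℝ) ^ (2 * θ) :=
      Real.self_le_rpow_of_one_le hlen (by linarith)
    have e2 : (l'.length : ℝ) ^ θ ≤ (2 * L + 1) ^ θ * (w.length : ℝ) ^ θ := by
      rw [← Real.mul_rpow (by positivity) (by positivity)]
      refine Real.rpow_le_rpow (by positivity) ?_ hθ0.le
      nlinarith
    have e3 : ((w.length : ℝ) ^ θ) ^ 2 = (w.length : ℝ) ^ (2 * θ) := by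
      rw [← Real.rpow_natCast, ← Real.rpow_mul (by positivity), Nat.cast_ofNat, mul_comm]
    have e4 : ((l'.length : ℝ) ^ θ) ^ 2 ≤
        ((2 * L + 1) ^ θ) ^ 2 * (w.length : ℝ) ^ (2 * θ) := by
      rw [← e3, ← mul_pow]
      gcongr
    have e5 : L + L * w.length ≤ 2 * L * (w.length : ℝ) ^ (2 * θ) := by nlinarith
    have e6 := mul_le_mul_of_nonneg_left e4 (by positivity : 0 ≤ 5 * κ ^ 2)
    linarith

theorem sum_comp_edgeLabelling {R : ℕ} {P : Matrix (Fin R) (Fin R) ℕ}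
    {σ : (i : Fin R) → Fin (rowSum P i) → Fin R} (hσ : IsEdgeLabelling P σ) (v : Fin R → ℝ)
    (i : Fin R) : ∑ k, v (σ i k) = (P.map (Nat.cast : ℕ → ℝ)).mulVec v i := by
  rw [← Finset.sum_fiberwise Finset.univ (σ i)]
  refine Finset.sum_congr rfl fun j _ => ?_
  rw [Finset.sum_congr rfl (g := fun _ => v j)
    (fun k hk => by rw [(Finset.mem_filter.mp hk).2]), Finset.sum_const, nsmul_eq_mul,
    ← Fintype.card_subtype, hσ i j]
  rfl

/-- The Perron–Frobenius eigenvalue is at most the largest row sum. -/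
theorem exists_le_rowSum {R : ℕ} [Nonempty (Fin R)] {P : Matrix (Fin R) (Fin R) ℕ} {lam : ℝ}
    {v : Fin R → ℝ} (hv : ∀ i, 0 < v i)
    (hPv : (P.map (Nat.cast : ℕ → ℝ)).mulVec v = lam • v) : ∃ i, lam ≤ rowSum P i := by
  obtain ⟨i, hi⟩ := Finite.exists_max v
  refine ⟨i, le_of_mul_le_mul_right ?_ (hv i)⟩
  have h := congrFun hPv i
  rw [Pi.smul_apply, smul_eq_mul] at h
  rw [← h, rowSum, Nat.cast_sum, Finset.sum_mul, Matrix.mulVec, dotProduct]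
  exact Finset.sum_le_sum fun j _ => mul_le_mul_of_nonneg_left (hi j) (Nat.cast_nonneg _)

end Snowflake

theorem mainTheorem11 (R : ℕ) (P : Matrix (Fin R) (Fin R) ℕ)
    (hP : (P.map (Nat.cast : ℕ → ℝ)).IsIrreducible)
    (lam : ℝ) (hlam : Snowflake.IsPerronFrobeniusEigenvalue P lam) (hlam1 : 1 < lam)
    (p q : ℕ) (hq : 0 < q) (hr : ∀ i, Snowflake.rowSum P i * q < p) :
    ∃ E : ℝ, 0 < E ∧
      ∀ (σ : (i : Fin R) → Fin (Snowflake.rowSum P i) → Fin R)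
        (T : Set ((i : Fin R) × Fin (Snowflake.rowSum P i))),
        Snowflake.IsEdgeLabelling P σ → Snowflake.IsMaximalTree σ T →
        (∀ (w : List (Snowflake.Letter (Snowflake.rowSum P) × Bool))
            (x : FreeGroup (Snowflake.Letter (Snowflake.rowSum P))) (N : ℤ),
          ((∃ i k, x = Snowflake.aGen i k) ∨ (∃ i, x = Snowflake.cGen i)) →
          (PresentedGroup.mk (Snowflake.relators p q σ T) (FreeGroup.mk w) : Snowflake.G p q σ T) =
            PresentedGroup.mk (Snowflake.relators p q σ T) x ^ N →
          (Snowflake.area (Snowflake.relators p q σ T) (FreeGroup.mk w * x ^ (-N)) : ℝ) ≤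
            E * (w.length : ℝ) ^ (2 * Real.logb lam ((p : ℝ) / q))) ∧
        (∀ y : ℝ, 0 ≤ y →
          (Snowflake.dehn (Snowflake.relators p q σ T) y : ℝ) ≤
            E * y ^ (2 * Real.logb lam ((p : ℝ) / q))) := by
  obtain ⟨v, hv, hPv⟩ := hlam
  have hlam0 : 0 < lam := by linarith
  have hq0 : (0 : ℝ) < q := by exact_mod_cast hq
  set θ := Real.logb lam ((p : ℝ) / q) with hθdef
  have key : ∀ (σ : (i : Fin R) → Fin (Snowflake.rowSum P i) → Fin R)
      (T : Set ((i : Fin R) × Fin (Snowflake.rowSum P i))),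
      ∃ E : ℝ, Snowflake.IsEdgeLabelling P σ → Snowflake.IsMaximalTree σ T →
        0 < θ ∧ Nonempty (Fin R) ∧
        ∀ (w : List (Snowflake.Letter (Snowflake.rowSum P) × Bool))
            (x : FreeGroup (Snowflake.Letter (Snowflake.rowSum P))) (N : ℤ),
          ((∃ i k, x = Snowflake.aGen i k) ∨ (∃ i, x = Snowflake.cGen i)) →
          (PresentedGroup.mk (Snowflake.relators p q σ T) (FreeGroup.mk w) : Snowflake.G p q σ T) =
            PresentedGroup.mk (Snowflake.relators p q σ T) x ^ N →
          Snowflake.Near (Snowflake.relators p q σ T) (FreeGroup.mk w) (x ^ N)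
            (E * (w.length : ℝ) ^ (2 * θ)) := by
    intro σ T
    by_cases hσT : Snowflake.IsEdgeLabelling P σ ∧ Snowflake.IsMaximalTree σ T
    swap
    · exact ⟨0, fun h1 h2 => absurd ⟨h1, h2⟩ hσT⟩
    obtain ⟨hσ, hT⟩ := hσT
    have hne : Nonempty (Fin R) := hT.2.2.connected.nonempty
    have hp : 0 < p := lt_of_le_of_lt (Nat.zero_le _) (hr hne.some)
    have hp0 : (0 : ℝ) < p := by exact_mod_cast hp
    have hsum : ∀ i, ∑ k, v (σ i k) = lam * v i := fun i => by
      rw [Snowflake.sum_comp_edgeLabelling hσ, hPv, Pi.smul_apply, smul_eq_mul]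
    have hm : ∀ i, 0 < Snowflake.rowSum P i := by
      intro i
      by_contra h
      have : IsEmpty (Fin (Snowflake.rowSum P i)) := by
        rw [Nat.eq_zero_of_not_pos h]
        infer_instance
      have := hsum i
      rw [Finset.univ_eq_empty, Finset.sum_empty] at this
      exact (mul_pos hlam0 (hv i)).ne this
    have hθ : 1 ≤ θ := by
      obtain ⟨i, hi⟩ := Snowflake.exists_le_rowSum hv hPv
      rw [hθdef, Real.le_logb_iff_rpow_le hlam1 (by positivity), Real.rpow_one, le_div_iff₀ hq0]
      have : ((Snowflake.rowSum P i * q : ℕ) : ℝ) < p := by exact_mod_cast hr i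
      push_cast at this
      nlinarith
    have hroot : (p : ℝ) ^ (1 / θ) = lam * (q : ℝ) ^ (1 / θ) := by
      have h1 : lam ^ θ = (p : ℝ) / q :=
        Real.rpow_logb hlam0 hlam1.ne' (by positivity)
      have h2 : (p : ℝ) = lam ^ θ * q := by rw [h1, div_mul_cancel₀ _ hq0.ne']
      rw [h2, Real.mul_rpow (by positivity) hq0.le, ← Real.rpow_mul hlam0.le,
        mul_one_div_cancel (by linarith), Real.rpow_one]
    have hV : 0 < ∑ i, v i := Finset.sum_pos (fun i _ => hv i) Finset.univ_nonempty
    have hsum' : ∀ i, ∑ k, v (σ i k) / (lam * ∑ i, v i) = v i / ∑ i, v i := fun i => by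
      rw [← Finset.sum_div, hsum, mul_div_mul_left _ _ hlam0.ne']
    obtain ⟨E, hE⟩ := Snowflake.exists_near_of_weighting hT hθ
      (Snowflake.nodeWeighting hm hp hq (σ := σ) (fun i k => v (σ i k) / (lam * ∑ i, v i))
        (fun i k => div_pos (hv _) (mul_pos hlam0 hV))
        (fun i => by
          rw [hsum', div_le_one hV]
          exact Finset.single_le_sum (fun j _ => (hv j).le) (Finset.mem_univ i))
        (fun i k => by
          rw [hsum', hroot]
          field_simp))
    exact ⟨E, fun _ _ => ⟨by linarith, hne, hE⟩⟩
  choose E hE using key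
  -- There are finitely many labellings and trees, so that one constant serves for all of them.
  obtain ⟨E₀, hE₀⟩ := Finite.exists_le fun σT :
    ((i : Fin R) → Fin (Snowflake.rowSum P i) → Fin R) ×
      Set ((i : Fin R) × Fin (Snowflake.rowSum P i)) => E σT.1 σT.2
  refine ⟨max E₀ 1, by positivity, fun σ T hσ hT => ?_⟩
  obtain ⟨hθ, ⟨i⟩, hnear⟩ := hE σ T hσ hT
  have hEle : E σ T ≤ max E₀ 1 := (hE₀ (σ, T)).trans (le_max_left _ _)
  have harea : ∀ (w : List (Snowflake.Letter (Snowflake.rowSum P) × Bool))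
      (x : FreeGroup (Snowflake.Letter (Snowflake.rowSum P))) (N : ℤ),
      ((∃ i k, x = Snowflake.aGen i k) ∨ (∃ i, x = Snowflake.cGen i)) →
      (PresentedGroup.mk (Snowflake.relators p q σ T) (FreeGroup.mk w) : Snowflake.G p q σ T) =
        PresentedGroup.mk (Snowflake.relators p q σ T) x ^ N →
      (Snowflake.area (Snowflake.relators p q σ T) (FreeGroup.mk w * x ^ (-N)) : ℝ) ≤
        max E₀ 1 * (w.length : ℝ) ^ (2 * θ) := by
    intro w x N hx hw
    rw [zpow_neg]
    refine (Snowflake.area_le_of_near (hnear w x N hx hw)).trans ?_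
    gcongr
  refine ⟨harea, fun y hy => ?_⟩
  have hbound : ∀ k ∈ {k | ∃ w : List (Snowflake.Letter (Snowflake.rowSum P) × Bool),
      (w.length : ℝ) ≤ y ∧ PresentedGroup.mk (Snowflake.relators p q σ T) (FreeGroup.mk w) = 1 ∧
        Snowflake.area (Snowflake.relators p q σ T) (FreeGroup.mk w) = k},
      k ≤ ⌊max E₀ 1 * y ^ (2 * θ)⌋₊ := by
    rintro k ⟨w, hwy, hw, rfl⟩
    refine Nat.le_floor ?_
    have := harea w (Snowflake.cGen i) 0 (Or.inr ⟨i, rfl⟩) (by rw [hw, zpow_zero])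
    rw [neg_zero, zpow_zero, mul_one] at this
    refine this.trans ?_
    gcongr
  have hle : Snowflake.dehn (Snowflake.relators p q σ T) y ≤ ⌊max E₀ 1 * y ^ (2 * θ)⌋₊ :=
    csSup_le' hbound
  exact (Nat.cast_le.mpr hle).trans (Nat.floor_le (by positivity))
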